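/- For a finite graph $G=(V,E)$ and $0<\delta\le 1/2$ let $$h_\delta(G)=\min\Big\{\frac{|E_G(A,V\setminus A)|}{|A|} : A\subseteq V,\ \delta\le\frac{|A|}{|V|}\le\frac12\Big\}$$ (with $\min\emptyset=+\infty$), where $E_G(A,B)$ is the set of edges of $G$ between $A$ and $B$. A sequence $G_n$ of finite graphs is expanding if $\liminf_n h_\delta(G_n)>0$ for every $0<\delta\le1/2$. Let $\mathscr G_\star$ be the space of connected locally finite rooted graphs modulo rooted isomorphism, with the distance $d((G_1,\rho_1),(G_2,\rho_2))=\inf\{1/(1+R): R\in\mathbb Z_{\ge0},\ B_R(\rho_1;G_1)\cong B_R(\rho_2;G_2)\}$, where $B_R(v;G)$ is the subgraph induced by the vertices within distance $R$ of $v$, rooted at $v$. The sequence $G_n=(V_n,E_n)$ of finite nonempty graphs converges locally weakly to a random element $(G,\rho)$ of $\mathscr G_\star$ if, for $U_n$ a uniformly random vertex of $G_n$, the connected component of $U_n$ in $G_n$, rooted at $U_n$, converges in law to $(G,\rho)$ in $\mathscr G_\star$. For an infinite graph $G$ let $p_c(G)$ be the supremum of those $p\in[0,1]$ for which Bernoulli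 bond percolation with edge probability $p$ on $G$ almost surely has no infinite component. **Theorem.** Let $G_n=(V_n,E_n)$ be an expanding sequence of finite graphs that converges locally weakly to a random rooted graph $(G,\rho)$ which is almost surely infinite (and connected, locally finite) with $\mathbb E[\deg\rho]<\infty$. For $p\in[0,1]$ let $\omega(G_n)$ denote Bernoulli bond percolation on $G_n$ with edge probability $p$. Then: (i) $p_c(G)$ is almost surely equal to a constant, denoted $p_c$. (ii) If $p<p_c$, then for every $\alpha>0$ the probability that the largest component of $\omega(G_n)$ has more than $\alpha|V_n|$ vertices tends to $0$ as $n\to\infty$. (iii) If $p>p_c$, then there is $\alpha>0$ such that the probability that the largest component of $\omega(G_n)$ has more than $\alpha|V_n|$ vertices tends to $1$ as $n\to\infty$. -/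

import Mathlib

open MeasureTheory Filter Topology
open scoped ENNReal unitInterval

/-! ### The space of rooted graphs -/

/-- A connected, locally finite graph with a distinguished vertex, the root. -/
structure RootedGraph where
  /-- the vertex set -/
  V : Type
  /-- the graph -/
  graph : SimpleGraph V
  /-- the root -/
  root : V
  connected : graph.Connected
  locallyFinite : ∀ v, (graph.neighborSet v).Finite

namespace RootedGraph

/-- The vertices within graph distance `R` of the root. -/
def ball (x : RootedGraph) (R : ℕ) : Set x.V := {w | x.graph.dist x.root w ≤ R}

theorem root_mem_ball (x : RootedGraph) (R : ℕ) : x.root ∈ x.ball R := by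
  simp [ball]

/-- The `R`-neighborhood of the root: the subgraph induced by the ball of radius `R`. -/
def ballGraph (x : RootedGraph) (R : ℕ) : SimpleGraph (x.ball R) := x.graph.induce (x.ball R)

/-- Rooted isomorphism of rooted graphs. -/
def Iso (x y : RootedGraph) : Prop := ∃ φ : x.graph ≃g y.graph, φ x.root = y.root

/-- Rooted isomorphism of the `R`-neighborhoods of the roots. -/
def BallIso (R : ℕ) (x y : RootedGraph) : Prop :=
  ∃ φ : x.ballGraph R ≃g y.ballGraph R,
    φ ⟨x.root, x.root_mem_ball R⟩ = ⟨y.root, y.root_mem_ball R⟩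

theorem Iso.refl (x : RootedGraph) : Iso x x := ⟨RelIso.refl _, rfl⟩

theorem Iso.symm {x y : RootedGraph} (h : Iso x y) : Iso y x := by
  obtain ⟨φ, hφ⟩ := h
  exact ⟨φ.symm, by rw [← hφ]; exact φ.symm_apply_apply _⟩

theorem Iso.trans {x y z : RootedGraph} (h : Iso x y) (h' : Iso y z) : Iso x z := by
  obtain ⟨φ, hφ⟩ := h
  obtain ⟨ψ, hψ⟩ := h'
  exact ⟨φ.trans ψ, by rw [← hψ, ← hφ]; rfl⟩

theorem BallIso.refl (R : ℕ) (x : RootedGraph) : BallIso R x x := ⟨RelIso.refl _, rfl⟩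

theorem BallIso.symm {R : ℕ} {x y : RootedGraph} (h : BallIso R x y) : BallIso R y x := by
  obtain ⟨φ, hφ⟩ := h
  exact ⟨φ.symm, by rw [← hφ]; exact φ.symm_apply_apply _⟩

theorem BallIso.trans {R : ℕ} {x y z : RootedGraph} (h : BallIso R x y) (h' : BallIso R y z) :
    BallIso R x z := by
  obtain ⟨φ, hφ⟩ := h
  obtain ⟨ψ, hψ⟩ := h'
  exact ⟨φ.trans ψ, by rw [← hψ, ← hφ]; rfl⟩

theorem dist_iso_le {x y : RootedGraph} (φ : x.graph ≃g y.graph) (hφ : φ x.root = y.root)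
    (w : x.V) : y.graph.dist y.root (φ w) ≤ x.graph.dist x.root w := by
  obtain ⟨p, hp⟩ := x.connected.exists_walk_length_eq_dist x.root w
  rw [← hp, ← hφ, ← p.length_map φ.toHom]
  exact SimpleGraph.dist_le _

theorem Iso.ballIso {x y : RootedGraph} (h : Iso x y) (R : ℕ) : BallIso R x y := by
  obtain ⟨φ, hφ⟩ := h
  have hφ' : φ.symm y.root = x.root := by rw [← hφ]; exact φ.symm_apply_apply _
  refine ⟨⟨⟨fun w => ⟨φ w.1, (dist_iso_le φ hφ w.1).trans w.2⟩,
    fun w => ⟨φ.symm w.1, (dist_iso_le φ.symm hφ' w.1).trans w.2⟩, ?_, ?_⟩, ?_⟩, ?_⟩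
  · intro w; ext; exact φ.symm_apply_apply _
  · intro w; ext; exact φ.apply_symm_apply _
  · intro a b; exact φ.map_adj_iff
  · ext; exact hφ

theorem dist_ballIso_le {R : ℕ} {x y : RootedGraph} (φ : x.ballGraph R ≃g y.ballGraph R)
    (hφ : φ ⟨x.root, x.root_mem_ball R⟩ = ⟨y.root, y.root_mem_ball R⟩) (S : ℕ) :
    ∀ w : x.ball R, x.graph.dist x.root w ≤ S → y.graph.dist y.root (φ w) ≤ S := by
  induction S with
  | zero =>
    intro w hw
    have hw' : x.root = w.1 := x.connected.dist_eq_zero_iff.1 (Nat.le_zero.1 hw)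
    have : w = ⟨x.root, x.root_mem_ball R⟩ := Subtype.ext hw'.symm
    rw [this, hφ]; simp
  | succ S ih =>
    intro w hw
    by_cases hS : x.graph.dist x.root w ≤ S
    · exact (ih w hS).trans (Nat.le_succ S)
    obtain ⟨p, hp⟩ := x.connected.exists_walk_length_eq_dist w.1 x.root
    rw [SimpleGraph.dist_comm] at hp
    obtain ⟨w, hwR⟩ := w
    simp only at *
    cases p with
    | nil => simp only [SimpleGraph.Walk.length_nil] at hp; omega
    | @cons _ u _ h p =>
      simp only [SimpleGraph.Walk.length_cons] at hp
      have hu : x.graph.dist x.root u ≤ S := by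
        rw [SimpleGraph.dist_comm]; exact (SimpleGraph.dist_le p).trans (by omega)
      have huR : u ∈ x.ball R := by
        have : x.graph.dist x.root w ≤ R := hwR
        show x.graph.dist x.root u ≤ R
        omega
      have h1 := ih ⟨u, huR⟩ hu
      have hadj : (x.ballGraph R).Adj ⟨u, huR⟩ ⟨w, hwR⟩ := h.symm
      have hadj' : y.graph.Adj (φ ⟨u, huR⟩).1 (φ ⟨w, hwR⟩).1 := φ.map_adj_iff.2 hadj
      have h2 := SimpleGraph.dist_eq_one_iff_adj.2 hadj'
      have h3 := y.connected.dist_triangle (u := y.root) (v := (φ ⟨u, huR⟩).1)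
        (w := (φ ⟨w, hwR⟩).1)
      omega

theorem BallIso.mono {R S : ℕ} {x y : RootedGraph} (h : BallIso R x y) (hSR : S ≤ R) :
    BallIso S x y := by
  obtain ⟨φ, hφ⟩ := h
  have hφ' : φ.symm ⟨y.root, y.root_mem_ball R⟩ = ⟨x.root, x.root_mem_ball R⟩ := by
    rw [← hφ]; exact φ.symm_apply_apply _
  refine ⟨⟨⟨fun w => ⟨(φ ⟨w.1, le_trans w.2 hSR⟩).1, dist_ballIso_le φ hφ S _ w.2⟩,
    fun w => ⟨(φ.symm ⟨w.1, le_trans w.2 hSR⟩).1, dist_ballIso_le φ.symm hφ' S _ w.2⟩,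
    ?_, ?_⟩, ?_⟩, ?_⟩
  · intro w
    have h := φ.symm_apply_apply ⟨w.1, le_trans w.2 hSR⟩
    exact Subtype.ext (congrArg (fun z => z.1) h)
  · intro w
    have h := φ.apply_symm_apply ⟨w.1, le_trans w.2 hSR⟩
    exact Subtype.ext (congrArg (fun z => z.1) h)
  · intro a b
    exact φ.map_adj_iff (v := ⟨a.1, le_trans a.2 hSR⟩) (w := ⟨b.1, le_trans b.2 hSR⟩)
  · exact Subtype.ext (congrArg (fun z => z.1) hφ)

theorem ballIso_zero (x y : RootedGraph) : BallIso 0 x y := by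
  have key : ∀ (z : RootedGraph) (a : z.ball 0), a = ⟨z.root, z.root_mem_ball 0⟩ := by
    intro z a
    exact Subtype.ext (z.connected.dist_eq_zero_iff.1 (Nat.le_zero.1 a.2)).symm
  refine ⟨⟨⟨fun _ => ⟨y.root, y.root_mem_ball 0⟩, fun _ => ⟨x.root, x.root_mem_ball 0⟩,
    fun a => (key x a).symm, fun a => (key y a).symm⟩, ?_⟩, rfl⟩
  intro a b
  rw [key x a, key x b]
  simp

/-- Rooted isomorphism as an equivalence relation. -/
instance setoid : Setoid RootedGraph := ⟨Iso, Iso.refl, Iso.symm, Iso.trans⟩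

/-- The degree of the root. -/
noncomputable def rootDegree (x : RootedGraph) : ℕ := (x.graph.neighborSet x.root).ncard

theorem Iso.rootDegree_eq {x y : RootedGraph} (h : Iso x y) : x.rootDegree = y.rootDegree := by
  obtain ⟨φ, hφ⟩ := h
  have : y.graph.neighborSet y.root = φ '' x.graph.neighborSet x.root := by
    ext w
    simp only [SimpleGraph.mem_neighborSet, Set.mem_image]
    constructor
    · intro hw
      refine ⟨φ.symm w, ?_, φ.apply_symm_apply w⟩
      rw [← φ.map_adj_iff, hφ]
      simpa using hw
    · rintro ⟨v, hv, rfl⟩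
      rw [← hφ]; exact φ.map_adj_iff.2 hv
  rw [rootDegree, rootDegree, this, Set.ncard_image_of_injective _ φ.injective]

end RootedGraph

/-- The space of connected locally finite rooted graphs modulo rooted isomorphism. -/
def RootedGraphSpace : Type 1 := Quotient RootedGraph.setoid

/-! ### Bernoulli bond percolation -/

/-- The law of Bernoulli bond percolation on `G` with edge probability `p`: the random set of open
edges contains each edge of `G` independently with probability `p`. -/
noncomputable def percolation {V : Type} (G : SimpleGraph V) (p : I) : Measure (Set (Sym2 V)) :=
  ProbabilityTheory.setBernoulli G.edgeSet p

/-- The subgraph formed by the open edges. -/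
def openGraph {V : Type} (ω : Set (Sym2 V)) : SimpleGraph V := SimpleGraph.fromEdgeSet ω

/-- The graph has an infinite connected component. -/
def HasInfiniteComponent {V : Type} (H : SimpleGraph V) : Prop :=
  ∃ C : H.ConnectedComponent, C.supp.Infinite

/-- The critical probability for Bernoulli bond percolation: the supremum of those `p ∈ [0,1]`
for which almost surely there is no infinite open component. -/
noncomputable def criticalProbability {V : Type} (G : SimpleGraph V) : ℝ :=
  sSup {p : ℝ | ∃ hp : p ∈ I,
    ∀ᵐ ω ∂percolation G ⟨p, hp⟩, ¬ HasInfiniteComponent (openGraph ω)}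

/-- The number of vertices of the largest connected component of a finite graph. -/
noncomputable def largestComponentSize {V : Type} [Finite V] (H : SimpleGraph V) : ℕ :=
  ⨆ C : H.ConnectedComponent, C.supp.ncard

theorem HasInfiniteComponent.of_iso {V W : Type} {G : SimpleGraph V} {H : SimpleGraph W}
    (φ : G ≃g H) (h : HasInfiniteComponent G) : HasInfiniteComponent H := by
  obtain ⟨C, hC⟩ := h
  refine ⟨φ.connectedComponentEquiv C, ?_⟩
  rw [← Set.infinite_coe_iff] at hC ⊢
  exact (SimpleGraph.ConnectedComponent.isoEquivSupp φ C).infinite_iff.1 hC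

theorem hasInfiniteComponent_openGraph_image {V W : Type} (e : V ≃ W) (ω : Set (Sym2 V)) :
    HasInfiniteComponent (openGraph (Sym2.map e '' ω)) ↔ HasInfiniteComponent (openGraph ω) := by
  have φ : openGraph ω ≃g openGraph (Sym2.map e '' ω) := by
    refine ⟨e, ?_⟩
    intro a b
    have : s(e a, e b) ∈ Sym2.map e '' ω ↔ s(a, b) ∈ ω := by
      rw [← Sym2.map_mk]
      exact (Sym2.map.injective e.injective).mem_set_image
    simp only [openGraph, SimpleGraph.fromEdgeSet_adj, this, ne_eq, e.injective.eq_iff]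
  exact ⟨.of_iso φ.symm, .of_iso φ⟩

theorem percolation_map_iso {V W : Type} {G : SimpleGraph V} {H : SimpleGraph W}
    (φ : G ≃g H) (p : I) :
    ∃ T : Set (Sym2 V) ≃ᵐ Set (Sym2 W), (∀ ω, T ω = Sym2.map φ '' ω) ∧
      (percolation G p).map T = percolation H p := by
  let E : Sym2 V ≃ Sym2 W := ⟨Sym2.map φ, Sym2.map φ.symm,
    fun e => by
      rw [Sym2.map_map]
      have : (φ.symm : W → V) ∘ φ = id := funext φ.symm_apply_apply
      rw [this, Sym2.map_id]; rfl,
    fun e => by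
      rw [Sym2.map_map]
      have : (φ : V → W) ∘ φ.symm = id := funext φ.apply_symm_apply
      rw [this, Sym2.map_id]; rfl⟩
  have hE : ∀ e, E e ∈ H.edgeSet ↔ e ∈ G.edgeSet := by
    intro e
    induction e using Sym2.ind with
    | _ a b => exact φ.map_adj_iff
  let P := MeasurableEquiv.piCongrLeft (fun _ : Sym2 W => Prop) E
  refine ⟨(MeasurableEquiv.setOfPred.symm.trans P).trans MeasurableEquiv.setOfPred, ?_, ?_⟩
  · intro ω
    ext e
    obtain ⟨e, rfl⟩ := E.surjective e
    have h1 : E e ∈ Sym2.map φ '' ω ↔ e ∈ ω := E.injective.mem_set_image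
    rw [h1]
    change P (fun i => i ∈ ω) (E e) ↔ e ∈ ω
    rw [MeasurableEquiv.coe_piCongrLeft, Equiv.piCongrLeft_apply_apply]
  · unfold percolation
    rw [ProbabilityTheory.setBernoulli_eq_map, ProbabilityTheory.setBernoulli_eq_map,
      ← Measure.infinitePi_map_piCongrLeft _ E]
    simp only [hE]
    change Measure.map _ (Measure.map MeasurableEquiv.setOfPred _) =
      Measure.map MeasurableEquiv.setOfPred _
    rw [Measure.map_map (MeasurableEquiv.measurable _) (MeasurableEquiv.measurable _),
      Measure.map_map (MeasurableEquiv.measurable _) (MeasurableEquiv.measurable _)]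
    rfl

theorem criticalProbability_eq_of_iso {V W : Type} {G : SimpleGraph V} {H : SimpleGraph W}
    (φ : G ≃g H) : criticalProbability G = criticalProbability H := by
  unfold criticalProbability
  congr 1
  ext p
  refine exists_congr fun hp => ?_
  obtain ⟨T, hT, hmap⟩ := percolation_map_iso φ ⟨p, hp⟩
  rw [← hmap, T.measurableEmbedding.ae_map_iff]
  simp only [hT]
  have key : ∀ ω, HasInfiniteComponent (openGraph (Sym2.map φ '' ω)) ↔
      HasInfiniteComponent (openGraph ω) := hasInfiniteComponent_openGraph_image φ.toEquiv
  simp only [key]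

namespace RootedGraphSpace

/-- The rooted isomorphism class of a rooted graph. -/
def mk (x : RootedGraph) : RootedGraphSpace := Quotient.mk RootedGraph.setoid x

/-- Rooted isomorphism of the `R`-neighborhoods of the roots. -/
def BallIso (R : ℕ) : RootedGraphSpace → RootedGraphSpace → Prop :=
  Quotient.lift₂ (RootedGraph.BallIso R) fun _ _ _ _ hx hy => propext
    ⟨fun h => ((hx.ballIso R).symm.trans h).trans (hy.ballIso R),
     fun h => ((hx.ballIso R).trans h).trans (hy.ballIso R).symm⟩

theorem BallIso.refl (R : ℕ) (x : RootedGraphSpace) : BallIso R x x := by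
  induction x using Quotient.inductionOn with
  | h x => exact RootedGraph.BallIso.refl R x

theorem BallIso.symm {R : ℕ} {x y : RootedGraphSpace} (h : BallIso R x y) : BallIso R y x := by
  induction x, y using Quotient.inductionOn₂ with
  | h x y => exact RootedGraph.BallIso.symm h

theorem BallIso.trans {R : ℕ} {x y z : RootedGraphSpace} (h : BallIso R x y)
    (h' : BallIso R y z) : BallIso R x z := by
  induction x, y, z using Quotient.inductionOn₃ with
  | h x y z => exact RootedGraph.BallIso.trans h h'

theorem BallIso.mono {R S : ℕ} {x y : RootedGraphSpace} (h : BallIso R x y) (hSR : S ≤ R) :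
    BallIso S x y := by
  induction x, y using Quotient.inductionOn₂ with
  | h x y => exact RootedGraph.BallIso.mono h hSR

theorem ballIso_zero (x y : RootedGraphSpace) : BallIso 0 x y := by
  induction x, y using Quotient.inductionOn₂ with
  | h x y => exact RootedGraph.ballIso_zero x y

/-- The local distance: the infimum of `1 / (1 + R)` over all `R` such that the `R`-neighborhoods
of the two roots are isomorphic as rooted graphs. -/
noncomputable def localDist (x y : RootedGraphSpace) : ℝ :=
  sInf {r : ℝ | ∃ R : ℕ, BallIso R x y ∧ r = 1 / (1 + (R : ℝ))}

theorem localDist_le {R : ℕ} {x y : RootedGraphSpace} (h : BallIso R x y) :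
    localDist x y ≤ 1 / (1 + (R : ℝ)) :=
  csInf_le ⟨0, by rintro _ ⟨R, -, rfl⟩; positivity⟩ ⟨R, h, rfl⟩

theorem localDist_nonneg (x y : RootedGraphSpace) : 0 ≤ localDist x y :=
  Real.sInf_nonneg (by rintro _ ⟨R, -, rfl⟩; positivity)

theorem exists_lt_of_localDist_lt {x y : RootedGraphSpace} {r : ℝ} (h : localDist x y < r) :
    ∃ R : ℕ, BallIso R x y ∧ 1 / (1 + (R : ℝ)) < r := by
  have hne : {r : ℝ | ∃ R : ℕ, BallIso R x y ∧ r = 1 / (1 + (R : ℝ))}.Nonempty :=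
    ⟨_, 0, ballIso_zero x y, rfl⟩
  obtain ⟨_, ⟨R, hR, rfl⟩, hlt⟩ := exists_lt_of_csInf_lt hne h
  exact ⟨R, hR, hlt⟩

noncomputable instance : PseudoMetricSpace RootedGraphSpace where
  dist := localDist
  dist_self x := by
    refine le_antisymm (le_of_forall_pos_lt_add fun ε hε => ?_) (localDist_nonneg x x)
    obtain ⟨R, hR⟩ := exists_nat_one_div_lt hε
    rw [zero_add]
    refine (localDist_le (BallIso.refl R x)).trans_lt ?_
    rwa [add_comm]
  dist_comm x y := by
    have : ∀ R, BallIso R x y ↔ BallIso R y x := fun R => ⟨.symm, .symm⟩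
    simp only [localDist, this]
  dist_triangle x y z := by
    refine le_of_forall_pos_lt_add fun ε hε => ?_
    obtain ⟨R, hR, hR'⟩ := exists_lt_of_localDist_lt (lt_add_of_pos_right (localDist x y) hε)
    obtain ⟨S, hS, hS'⟩ := exists_lt_of_localDist_lt (lt_add_of_pos_right (localDist y z) hε)
    have hx := localDist_nonneg x y
    have hy := localDist_nonneg y z
    rcases le_total R S with hRS | hRS
    · have := localDist_le (hR.trans (hS.mono hRS))
      linarith
    · have := localDist_le ((hR.mono hRS).trans hS)
      linarith

noncomputable instance : MeasurableSpace RootedGraphSpace := borel _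

instance : BorelSpace RootedGraphSpace := ⟨rfl⟩

/-- The degree of the root. -/
noncomputable def rootDegree : RootedGraphSpace → ℕ :=
  Quotient.lift RootedGraph.rootDegree fun _ _ h => RootedGraph.Iso.rootDegree_eq h

/-- The underlying graph has infinitely many vertices. -/
def IsInfinite : RootedGraphSpace → Prop :=
  Quotient.lift (fun x : RootedGraph => Infinite x.V) fun x y (h : RootedGraph.Iso x y) =>
    h.elim fun φ _ => propext φ.toEquiv.infinite_iff

/-- The critical probability of the underlying graph. -/
noncomputable def criticalProbability : RootedGraphSpace → ℝ :=
  Quotient.lift (fun x : RootedGraph => _root_.criticalProbability x.graph) fun x y (h : RootedGraph.Iso x y) =>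
    h.elim fun φ _ => criticalProbability_eq_of_iso φ

end RootedGraphSpace

/-! ### Local weak convergence and expansion of finite graphs -/

/-- The connected component of `v` in the finite graph `G`, rooted at `v`. -/
def rootedComponent {V : Type} [Finite V] (G : SimpleGraph V) (v : V) : RootedGraph where
  V := G.connectedComponentMk v
  graph := (G.connectedComponentMk v).toSimpleGraph
  root := ⟨v, SimpleGraph.ConnectedComponent.connectedComponentMk_mem⟩
  connected := (G.connectedComponentMk v).connected_toSimpleGraph
  locallyFinite _ := Set.toFinite _

/-- The law of the finite graph `G` seen from a uniformly random vertex `U`, that is, of the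
connected component of `U` rooted at `U`. -/
noncomputable def localLaw {V : Type} [Fintype V] [Nonempty V] (G : SimpleGraph V) :
    ProbabilityMeasure RootedGraphSpace :=
  ⟨((PMF.uniformOfFintype V).map fun v => RootedGraphSpace.mk (rootedComponent G v)).toMeasure,
    inferInstance⟩

/-- Local weak convergence of a sequence of finite graphs to a random rooted graph of law `μ`:
convergence in law of `G n` seen from a uniformly random vertex. -/
def LocallyWeaklyConverges {V : ℕ → Type} [∀ n, Fintype (V n)] [∀ n, Nonempty (V n)]
    (G : ∀ n, SimpleGraph (V n)) (μ : ProbabilityMeasure RootedGraphSpace) : Prop :=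
  Tendsto (fun n => localLaw (G n)) atTop (𝓝 μ)

/-- The set of edges of `G` between `A` and `B`. -/
def edgesBetween {V : Type} (G : SimpleGraph V) (A B : Set V) : Set (Sym2 V) :=
  {e ∈ G.edgeSet | ∃ a ∈ A, ∃ b ∈ B, e = s(a, b)}

/-- The expansion constant `h_δ(G)`: the minimum of `|E(A, V \ A)| / |A|` over the vertex sets `A`
with `δ ≤ |A| / |V| ≤ 1 / 2` (and `∞` if there is no such set). -/
noncomputable def expansionConstant {V : Type} [Fintype V] (δ : ℝ) (G : SimpleGraph V) : ℝ≥0∞ :=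
  ⨅ (A : Finset V) (_ : δ ≤ (A.card : ℝ) / Fintype.card V ∧
      (A.card : ℝ) / Fintype.card V ≤ 1 / 2),
    ((edgesBetween G A (A : Set V)ᶜ).ncard : ℝ≥0∞) / (A.card : ℝ≥0∞)

/-- Expanding sequences of finite graphs. -/
def IsExpanding {V : ℕ → Type} [∀ n, Fintype (V n)] (G : ∀ n, SimpleGraph (V n)) : Prop :=
  ∀ δ : ℝ, 0 < δ → δ ≤ 1 / 2 → 0 < liminf (fun n => expansionConstant δ (G n)) atTop

/-!
The critical probability of the limit is the threshold for a giant component because, on an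
expanding sequence, a giant component and an infinite cluster of the limit produce each other, at
the cost of an arbitrarily small increase of the edge probability.

Everything rests on *sprinkling* (`exists_sprinkle`): for `p < q`, the open edges at `q` are the
union of those at `p` and of an independent percolation configuration. Laws of random edge sets are
identified through their void probabilities (`measure_set_ext`), which turns unions, restrictions
and independence into identities between products.

*Locality.* Whether the cluster of a vertex has at least `k` vertices depends only on the ball of
radius `k` (`bigCluster_comap_iff`). Hence the probability of that event is a continuous function
on the space of rooted graphs, and the expected fraction of vertices of `G n` in clusters of size at
least `k` converges to the corresponding probability for the limit; the latter decreases, as `k`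
grows, to the probability `percolationProb μ p` that the root percolates. The fraction is
concentrated, as two random vertices are far apart (`tendsto_bigCount_lt`). If
`percolationProb μ p = 0`, Markov's inequality excludes a giant component (`tendsto_giant_zero`).

*Expansion without degree bounds.* Vertices of degree more than `M` are removed. They are few, and
since the root has finite expected degree in the limit, they are joined to the remaining vertices by
few edges, so large sets still have large boundaries (`exists_truncated_expansion`), now in a graph
with at most `M * |V|` edges. There, two large sets are always joined by a path of bounded length
(`exists_short_walk`), even after the removal of a small fraction of the edges, so sprinkling joins
two given large sets except with exponentially small probability (`percolation_not_joined_le`).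

*Giant components.* If `percolationProb μ p > 0`, a positive fraction of the vertices of `G n` lies
in clusters of size at least `k`. If after sprinkling there were no giant component, these clusters
could be divided into two large groups that are not joined; there are at most `2 ^ (|V| / k)`
divisions, too few to compensate the exponential bound when `k` is large (`exists_giant`).

*The critical probability is constant.* Suppose that the root percolates with positive probability
at `p`, but that with positive probability the limit does not percolate at `q > p`. Then for large
`k`, a positive fraction of the vertices of `G n` have a tiny probability of being in a cluster of
size at least `k` at `q`. However, most of them are within bounded distance of the giant component
that exists already below `q`, and sprinkling attaches them to it with probability bounded below,
a contradiction (`ae_infProb_pos`).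
-/

/-! ### Random sets with independent elements -/

section SetBernoulli

open ProbabilityTheory unitInterval

variable {ι κ : Type*}

/-- The void probabilities of a random set with independent elements. -/
theorem setBernoulli_void (u : Set ι) (p : I) (F : Finset ι) [DecidablePred (· ∈ u)] :
    setBernoulli u p {ω | ∀ i ∈ F, i ∉ ω} =
      ∏ i ∈ F, if i ∈ u then (toNNReal (σ p) : ℝ≥0∞) else 1 := by
  classical
  rw [setBernoulli_apply']
  have : ((fun p : ι → Prop => {i | p i}) ⁻¹' {ω | ∀ i ∈ F, i ∉ ω}) =
      (F : Set ι).pi fun _ => {False} := by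
    ext f; simp [Set.mem_pi]
  rw [this, Measure.infinitePi_pi]
  · refine Finset.prod_congr rfl fun i _ => ?_
    by_cases hi : i ∈ u
    · simp [hi]
    · simp [hi, ← ENNReal.coe_add]
  · intro i _; exact MeasurableSet.of_discrete

theorem measurableSet_void (F : Finset ι) : MeasurableSet {ω : Set ι | ∀ i ∈ F, i ∉ ω} := by
  have : {ω : Set ι | ∀ i ∈ F, i ∉ ω} = ⋂ i ∈ F, {ω | i ∉ ω} := by ext; simp
  rw [this]
  exact Finset.measurableSet_biInter _ fun i _ =>
    measurableSet_setOfPred.2 (measurable_set_notMem i)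

/-- A random set is determined in law by its void probabilities. -/
theorem measure_set_ext {μ ν : Measure (Set ι)} [IsProbabilityMeasure μ] [IsProbabilityMeasure ν]
    (h : ∀ F : Finset ι, μ {ω | ∀ i ∈ F, i ∉ ω} = ν {ω | ∀ i ∈ F, i ∉ ω}) : μ = ν := by
  classical
  refine ext_of_generate_finite (Set.range fun F : Finset ι => {ω : Set ι | ∀ i ∈ F, i ∉ ω})
    ?_ ?_ ?_ (by simp)
  · apply le_antisymm
    · have : Measurable[MeasurableSpace.generateFrom
          (Set.range fun F : Finset ι => {ω : Set ι | ∀ i ∈ F, i ∉ ω})] (id : Set ι → Set ι) := by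
        refine @measurable_set_iff _ _ (_) _ |>.2 fun a => ?_
        refine @measurable_to_prop _ (_) _ ?_
        have : (fun x : Set ι => a ∈ id x) ⁻¹' {True} =
            {ω : Set ι | ∀ i ∈ ({a} : Finset ι), i ∉ ω}ᶜ := by
          ext; simp
        rw [this]
        exact MeasurableSet.compl (MeasurableSpace.measurableSet_generateFrom ⟨_, rfl⟩)
      intro s hs
      exact this hs
    · refine MeasurableSpace.generateFrom_le ?_
      rintro _ ⟨F, rfl⟩
      exact measurableSet_void F
  · rintro _ ⟨F, rfl⟩ _ ⟨F', rfl⟩ -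
    refine ⟨F ∪ F', ?_⟩
    ext ω
    simp only [Finset.mem_union, Set.mem_inter_iff, Set.mem_ofPred_eq]
    grind
  · rintro _ ⟨F, rfl⟩
    exact h F

theorem measurable_union_pair : Measurable fun x : Set ι × Set ι => x.1 ∪ x.2 :=
  measurable_set_iff.2 fun a => by
    change Measurable fun x : Set ι × Set ι => a ∈ x.1 ∨ a ∈ x.2
    exact ((measurable_set_mem a).comp measurable_fst).or
      ((measurable_set_mem a).comp measurable_snd)

theorem measurable_preimage_set (f : κ → ι) : Measurable fun ω : Set ι => f ⁻¹' ω :=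
  measurable_set_iff.2 fun a => measurable_set_mem (f a)

open Classical in
theorem setBernoulli_prod_map_union {u v w : Set ι} {p q r : I}
    (h : ∀ i, (if i ∈ w then (toNNReal (σ r) : ℝ≥0∞) else 1) =
      (if i ∈ u then (toNNReal (σ p) : ℝ≥0∞) else 1) *
        if i ∈ v then (toNNReal (σ q) : ℝ≥0∞) else 1) :
    ((setBernoulli u p).prod (setBernoulli v q)).map (fun x => x.1 ∪ x.2) = setBernoulli w r := by
  have := Measure.isProbabilityMeasure_map (μ := (setBernoulli u p).prod (setBernoulli v q))
    measurable_union_pair.aemeasurable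
  refine measure_set_ext fun F => ?_
  rw [Measure.map_apply measurable_union_pair (measurableSet_void F)]
  have : (fun x : Set ι × Set ι => x.1 ∪ x.2) ⁻¹' {ω | ∀ i ∈ F, i ∉ ω} =
      {ω | ∀ i ∈ F, i ∉ ω} ×ˢ {ω | ∀ i ∈ F, i ∉ ω} := by
    ext x; simp only [Set.mem_preimage, Set.mem_ofPred_eq, Set.mem_union, Set.mem_prod]; grind
  rw [this, Measure.prod_prod, setBernoulli_void, setBernoulli_void, setBernoulli_void,
    ← Finset.prod_mul_distrib]
  exact Finset.prod_congr rfl fun i _ => (h i).symm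

/-- A random subset of a disjoint union consists of independent random subsets of the parts. -/
theorem setBernoulli_prod_map_union_of_disjoint {u v : Set ι} (h : Disjoint u v) (p : I) :
    ((setBernoulli u p).prod (setBernoulli v p)).map (fun x => x.1 ∪ x.2) =
      setBernoulli (u ∪ v) p := by
  classical
  refine setBernoulli_prod_map_union fun i => ?_
  have : i ∈ u → i ∉ v := fun hu => Set.disjoint_left.1 h hu
  by_cases hu : i ∈ u <;> by_cases hv : i ∈ v <;> simp_all

/-- Sprinkling: a denser random set is the union of a sparser one and an independent
random set. -/
theorem exists_sprinkle {p q : I} (h : p < q) : ∃ s : I, 0 < s ∧ ∀ {ι : Type} (u : Set ι),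
    ((setBernoulli u p).prod (setBernoulli u s)).map (fun x => x.1 ∪ x.2) = setBernoulli u q := by
  classical
  have hpq : (p : ℝ) < q := h
  have hq := q.2.2
  have hp := p.2.1
  have h1 : (0 : ℝ) < 1 - p := by linarith
  have hs : ((q : ℝ) - p) / (1 - p) ∈ I :=
    ⟨div_nonneg (by linarith) h1.le, (div_le_one h1).2 (by linarith)⟩
  refine ⟨⟨_, hs⟩, ?_, fun {ι} u => setBernoulli_prod_map_union fun i => ?_⟩
  · rw [← Subtype.coe_lt_coe]
    exact div_pos (by linarith) h1
  · by_cases hi : i ∈ u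
    · simp only [hi, if_true]
      rw [← ENNReal.coe_mul, ENNReal.coe_inj]
      ext
      simp only [coe_toNNReal, coe_symm_eq, NNReal.coe_mul]
      field_simp
      ring
    · simp [hi]

theorem setBernoulli_map_preimage {f : κ → ι} (hf : f.Injective) (u : Set ι) (p : I) :
    (setBernoulli u p).map (fun ω => f ⁻¹' ω) = setBernoulli (f ⁻¹' u) p := by
  classical
  have := Measure.isProbabilityMeasure_map (μ := setBernoulli u p)
    (measurable_preimage_set f).aemeasurable
  refine measure_set_ext fun F => ?_
  rw [Measure.map_apply (measurable_preimage_set f) (measurableSet_void F)]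
  have : (fun ω : Set ι => f ⁻¹' ω) ⁻¹' {ω | ∀ i ∈ F, i ∉ ω} =
      {ω | ∀ i ∈ F.image f, i ∉ ω} := by ext; simp
  rw [this, setBernoulli_void, setBernoulli_void, Finset.prod_image hf.injOn]
  rfl

theorem setBernoulli_superset {u : Set ι} {F : Finset ι} (hF : (F : Set ι) ⊆ u) (p : I) :
    setBernoulli u p {ω | (F : Set ι) ⊆ ω} = (toNNReal p : ℝ≥0∞) ^ F.card := by
  classical
  rw [setBernoulli_apply']
  have : ((fun p : ι → Prop => {i | p i}) ⁻¹' {ω | (F : Set ι) ⊆ ω}) =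
      (F : Set ι).pi fun _ => {True} := by
    ext f; simp [Set.mem_pi, Set.subset_def]
  rw [this, Measure.infinitePi_pi]
  · rw [Finset.prod_congr rfl (g := fun _ => (toNNReal p : ℝ≥0∞)), Finset.prod_const]
    intro i hi
    simp [hF hi]
  · intro i _; exact MeasurableSet.of_discrete

end SetBernoulli

/-! ### Large clusters and their locality -/

/-- The connected component of `v` in `H` has at least `k` vertices. -/
def BigCluster {V : Type} (k : ℕ) (H : SimpleGraph V) (v : V) : Prop :=
  (k : ℕ∞) ≤ {w | H.Reachable v w}.encard

section Clusters

variable {V W : Type}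

theorem openGraph_adj {ω : Set (Sym2 V)} {a b : V} :
    (openGraph ω).Adj a b ↔ s(a, b) ∈ ω ∧ a ≠ b := by
  simp [openGraph]

theorem openGraph_mono {ω ω' : Set (Sym2 V)} (h : ω ⊆ ω') : openGraph ω ≤ openGraph ω' :=
  SimpleGraph.fromEdgeSet_mono h

theorem openGraph_le {G : SimpleGraph V} {ω : Set (Sym2 V)} (h : ω ⊆ G.edgeSet) :
    openGraph ω ≤ G := by
  intro a b hab
  exact h (openGraph_adj.1 hab).1

theorem BigCluster.mono_graph {k : ℕ} {H H' : SimpleGraph V} (h : H ≤ H') {v : V}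
    (hb : BigCluster k H v) : BigCluster k H' v :=
  le_trans hb (Set.encard_le_encard fun _ hw => SimpleGraph.Reachable.mono h hw)

theorem BigCluster.anti {k l : ℕ} (hkl : l ≤ k) {H : SimpleGraph V} {v : V}
    (hb : BigCluster k H v) : BigCluster l H v :=
  le_trans (by exact_mod_cast hkl) hb

theorem BigCluster.of_reachable {k : ℕ} {H : SimpleGraph V} {v w : V} (h : H.Reachable v w)
    (hb : BigCluster k H v) : BigCluster k H w :=
  le_trans hb (Set.encard_le_encard fun _ hu => h.symm.trans hu)

theorem forall_bigCluster_iff {H : SimpleGraph V} {v : V} :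
    (∀ k, BigCluster k H v) ↔ {w | H.Reachable v w}.Infinite := by
  rw [← Set.encard_eq_top_iff, ENat.eq_top_iff_forall_ge]
  rfl

/-- In a cluster of fewer than `k` vertices, every vertex is reached by a path with fewer than `k`
vertices. -/
theorem exists_walk_length_lt {H : SimpleGraph V} {k : ℕ} {v w : V}
    (hb : ¬ BigCluster k H v) (hw : H.Reachable v w) : ∃ p : H.Walk v w, p.length + 1 < k := by
  classical
  obtain ⟨p, hp⟩ := hw.exists_isPath
  refine ⟨p, ?_⟩
  by_contra! hk
  refine hb ?_
  have h1 : (p.support.toFinset : Set V) ⊆ {w | H.Reachable v w} := by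
    intro u hu
    simp only [List.coe_toFinset, Set.mem_ofPred_eq] at hu
    exact ⟨p.takeUntil u hu⟩
  refine le_trans ?_ (Set.encard_le_encard h1)
  rw [Set.encard_coe_eq_coe_finsetCard, List.toFinset_card_of_nodup hp.support_nodup,
    SimpleGraph.Walk.length_support]
  exact_mod_cast hk

/-- Whether the cluster of a vertex has at least `k` vertices can be read off from any injected
vertex set that contains the ball of radius `k` around that vertex. -/
theorem bigCluster_comap_iff {G : SimpleGraph V} {f : W → V} (hf : f.Injective) {k : ℕ} {w₀ : W}
    (hball : ∀ u, (∃ p : G.Walk (f w₀) u, p.length ≤ k) → u ∈ Set.range f)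
    {ω : Set (Sym2 V)} (hω : ω ⊆ G.edgeSet) :
    BigCluster k (openGraph (Sym2.map f ⁻¹' ω)) w₀ ↔ BigCluster k (openGraph ω) (f w₀) := by
  have hadj : ∀ a b, (openGraph (Sym2.map f ⁻¹' ω)).Adj a b ↔ (openGraph ω).Adj (f a) (f b) := by
    intro a b
    simp [openGraph_adj, hf.eq_iff]
  let φ : openGraph (Sym2.map f ⁻¹' ω) →g openGraph ω := ⟨f, fun h => (hadj _ _).1 h⟩
  constructor
  · intro h
    refine le_trans h ?_
    rw [← hf.encard_image]
    refine Set.encard_le_encard ?_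
    rintro _ ⟨w, hw, rfl⟩
    exact SimpleGraph.Reachable.map φ hw
  · intro h
    by_contra hn
    refine absurd h ?_
    have key : {u | (openGraph ω).Reachable (f w₀) u} ⊆
        f '' {w | (openGraph (Sym2.map f ⁻¹' ω)).Reachable w₀ w} := by
      intro u hu
      rw [Set.mem_ofPred_eq, SimpleGraph.reachable_iff_reflTransGen] at hu
      induction hu with
      | refl => exact ⟨w₀, SimpleGraph.Reachable.refl _, rfl⟩
      | tail _ hbc ih =>
        obtain ⟨w, hw, rfl⟩ := ih
        obtain ⟨p, hp⟩ := exists_walk_length_lt hn hw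
        obtain ⟨w', rfl⟩ := hball _ ⟨((p.map φ).mapLe (openGraph_le hω)).concat
          (openGraph_le hω hbc), by
            rw [SimpleGraph.Walk.length_concat]
            simp only [SimpleGraph.Walk.length_map]
            omega⟩
        exact ⟨w', SimpleGraph.Reachable.trans hw ((hadj _ _).2 hbc).reachable, rfl⟩
    intro h
    refine hn (le_trans h ((Set.encard_le_encard key).trans ?_))
    rw [hf.encard_image]

theorem percolation_ae_subset [Countable V] (G : SimpleGraph V) (p : I) :
    ∀ᵐ ω ∂percolation G p, ω ⊆ G.edgeSet :=
  have : Countable (Sym2 V) := Quotient.countable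
  ProbabilityTheory.setBernoulli_ae_subset

instance (G : SimpleGraph V) (p : I) : IsProbabilityMeasure (percolation G p) :=
  inferInstanceAs (IsProbabilityMeasure (ProbabilityTheory.setBernoulli _ _))

/-- All events about a finite graph are measurable. -/
theorem measurableSet_of_finite [Finite W] (S : Set (Set (Sym2 W))) : MeasurableSet S :=
  have : Finite (Sym2 W) := inferInstance
  S.toFinite.measurableSet

theorem percolation_map_preimage {G : SimpleGraph V} {K : SimpleGraph W} {f : W → V}
    (hf : f.Injective) (hK : ∀ a b, K.Adj a b ↔ G.Adj (f a) (f b)) (p : I) :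
    (percolation G p).map (fun ω => Sym2.map f ⁻¹' ω) = percolation K p := by
  rw [percolation, setBernoulli_map_preimage (Sym2.map.injective hf), percolation]
  congr 1
  ext e
  induction e using Sym2.ind with
  | _ a b => exact (hK a b).symm

/-- The configuration may contain pairs that are not edges of `G`, but only with probability zero. -/
theorem bigCluster_ae_eq [Countable V] {G : SimpleGraph V} {f : W → V} (hf : f.Injective) {k : ℕ}
    {w₀ : W} (hball : ∀ u, (∃ p : G.Walk (f w₀) u, p.length ≤ k) → u ∈ Set.range f) (p : I) :
    {ω | BigCluster k (openGraph ω) (f w₀)} =ᵐ[percolation G p]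
      (fun ω => Sym2.map f ⁻¹' ω) ⁻¹' {ω | BigCluster k (openGraph ω) w₀} := by
  filter_upwards [percolation_ae_subset G p] with ω hω
  exact propext (bigCluster_comap_iff hf hball hω).symm

theorem percolation_bigCluster_comap [Countable V] [Finite W] {G : SimpleGraph V}
    {K : SimpleGraph W} {f : W → V}
    (hf : f.Injective) (hK : ∀ a b, K.Adj a b ↔ G.Adj (f a) (f b)) {k : ℕ} {w₀ : W}
    (hball : ∀ u, (∃ p : G.Walk (f w₀) u, p.length ≤ k) → u ∈ Set.range f) (p : I) :
    percolation G p {ω | BigCluster k (openGraph ω) (f w₀)} =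
      percolation K p {ω | BigCluster k (openGraph ω) w₀} := by
  rw [measure_congr (bigCluster_ae_eq hf hball p), ← percolation_map_preimage hf hK p,
    Measure.map_apply (measurable_preimage_set _) (measurableSet_of_finite _)]

end Clusters

namespace RootedGraph

theorem finite_ball (x : RootedGraph) (R : ℕ) : (x.ball R).Finite := by
  induction R with
  | zero =>
    refine (Set.finite_singleton x.root).subset fun w hw => ?_
    exact (x.connected.dist_eq_zero_iff.1 (Nat.le_zero.1 hw)).symm
  | succ R ih =>
    refine (ih.union (ih.biUnion fun v _ => x.locallyFinite v)).subset fun w hw => ?_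
    by_cases hR : x.graph.dist x.root w ≤ R
    · exact Or.inl hR
    obtain ⟨p, hp⟩ := x.connected.exists_walk_length_eq_dist w x.root
    rw [SimpleGraph.dist_comm] at hp
    have hw' : x.graph.dist x.root w ≤ R + 1 := hw
    cases p with
    | nil => simp only [SimpleGraph.Walk.length_nil] at hp; omega
    | @cons _ u _ h p =>
      simp only [SimpleGraph.Walk.length_cons] at hp
      refine Or.inr (Set.mem_biUnion (x := u) ?_ h.symm)
      change x.graph.dist x.root u ≤ R
      rw [SimpleGraph.dist_comm]
      exact (SimpleGraph.dist_le p).trans (by omega)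

theorem countable (x : RootedGraph) : Countable x.V := by
  rw [← Set.countable_univ_iff]
  have : (Set.univ : Set x.V) = ⋃ R, x.ball R := by
    ext w; simp only [Set.mem_univ, Set.mem_iUnion, true_iff]
    exact ⟨x.graph.dist x.root w, le_refl (x.graph.dist x.root w)⟩
  rw [this]
  exact Set.countable_iUnion fun R => (x.finite_ball R).countable

/-- The probability that the cluster of the root has at least `k` vertices. -/
noncomputable def bigProb (k : ℕ) (p : I) (x : RootedGraph) : ℝ :=
  (percolation x.graph p).real {ω | BigCluster k (openGraph ω) x.root}

/-- The probability that the cluster of the root is infinite. -/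
noncomputable def infProb (p : I) (x : RootedGraph) : ℝ :=
  (percolation x.graph p).real {ω | ∀ k, BigCluster k (openGraph ω) x.root}

theorem mem_ball_of_walk (x : RootedGraph) {R : ℕ} {u : x.V}
    (h : ∃ p : x.graph.Walk x.root u, p.length ≤ R) : u ∈ x.ball R := by
  obtain ⟨p, hp⟩ := h
  exact (SimpleGraph.dist_le p).trans hp

theorem BallIso.bigProb_eq {k : ℕ} {x y : RootedGraph} (h : BallIso k x y) (p : I) :
    bigProb k p x = bigProb k p y := by
  obtain ⟨φ, hφ⟩ := h
  have := x.countable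
  have := y.countable
  have : Finite (x.ball k) := x.finite_ball k
  have h1 := percolation_bigCluster_comap (G := x.graph) (K := x.ballGraph k)
    (f := Subtype.val) Subtype.val_injective (fun _ _ => Iff.rfl) (k := k)
    (w₀ := ⟨x.root, x.root_mem_ball k⟩) (fun u hu => ⟨⟨u, x.mem_ball_of_walk hu⟩, rfl⟩) p
  have h2 := percolation_bigCluster_comap (G := y.graph) (K := x.ballGraph k)
    (f := fun w => (φ w).1) (Subtype.val_injective.comp φ.injective)
    (fun a b => (φ.map_adj_iff (v := a) (w := b)).symm) (k := k)
    (w₀ := ⟨x.root, x.root_mem_ball k⟩) (fun u hu => by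
      rw [hφ] at hu
      exact ⟨φ.symm ⟨u, y.mem_ball_of_walk hu⟩, by simp⟩) p
  rw [hφ] at h2
  rw [bigProb, bigProb, measureReal_def, measureReal_def, h1, h2]

theorem bigProb_rootedComponent {V : Type} [Finite V] (G : SimpleGraph V) (v : V) (k : ℕ) (p : I) :
    bigProb k p (rootedComponent G v) =
      (percolation G p).real {ω | BigCluster k (openGraph ω) v} := by
  have : Finite (G.connectedComponentMk v) := Subtype.finite
  have h := percolation_bigCluster_comap (G := G) (K := (G.connectedComponentMk v).toSimpleGraph)
    (f := Subtype.val) Subtype.val_injective (fun _ _ => Iff.rfl) (k := k)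
    (w₀ := ⟨v, SimpleGraph.ConnectedComponent.connectedComponentMk_mem⟩) (fun u hu => ?_) p
  · rw [bigProb, measureReal_def, measureReal_def, h]
    rfl
  · obtain ⟨q, -⟩ := hu
    refine ⟨⟨u, ?_⟩, rfl⟩
    exact (SimpleGraph.ConnectedComponent.eq.2 ⟨q⟩).symm

theorem nullMeasurableSet_bigCluster (x : RootedGraph) (v : x.V) (k : ℕ) (p : I) :
    NullMeasurableSet {ω | BigCluster k (openGraph ω) v} (percolation x.graph p) := by
  have := x.countable
  let y : RootedGraph := ⟨x.V, x.graph, v, x.connected, x.locallyFinite⟩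
  have : Finite (y.ball k) := y.finite_ball k
  have h1 := bigCluster_ae_eq (G := x.graph) 
    (f := (Subtype.val : y.ball k → x.V)) Subtype.val_injective (k := k)
    (w₀ := ⟨v, y.root_mem_ball k⟩) (fun u hu => ⟨⟨u, y.mem_ball_of_walk hu⟩, rfl⟩) p
  refine NullMeasurableSet.congr ?_ h1.symm
  exact (measurable_preimage_set _ (measurableSet_of_finite _)).nullMeasurableSet

theorem bigProb_nonneg (k : ℕ) (p : I) (x : RootedGraph) : 0 ≤ bigProb k p x := measureReal_nonneg

theorem bigProb_le_one (k : ℕ) (p : I) (x : RootedGraph) : bigProb k p x ≤ 1 := measureReal_le_one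

theorem infProb_le_bigProb (k : ℕ) (p : I) (x : RootedGraph) : infProb p x ≤ bigProb k p x :=
  measureReal_mono fun _ h => h k

theorem antitone_bigProb (p : I) (x : RootedGraph) : Antitone fun k => bigProb k p x :=
  fun _ _ hkl => measureReal_mono fun _ h => BigCluster.anti hkl h

theorem tendsto_bigProb (p : I) (x : RootedGraph) :
    Tendsto (fun k => bigProb k p x) atTop (𝓝 (infProb p x)) := by
  have h := tendsto_measure_iInter_atTop (μ := percolation x.graph p)
    (s := fun k => {ω | BigCluster k (openGraph ω) x.root})
    (fun k => x.nullMeasurableSet_bigCluster x.root k p)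
    (fun _ _ hkl _ h => BigCluster.anti hkl h) ⟨0, measure_ne_top _ _⟩
  have h' := (ENNReal.tendsto_toReal (measure_ne_top _ _)).comp h
  have he : (⋂ k, {ω | BigCluster k (openGraph ω) x.root}) =
      {ω | ∀ k, BigCluster k (openGraph ω) x.root} := by ext; simp
  rw [he] at h'
  exact h'

end RootedGraph

/-! ### Infinite clusters and the critical probability -/

namespace RootedGraph

/-- If the cluster of the root is almost surely finite, then below that edge probability there is
almost surely no infinite component: sprinkling would connect it to the root. -/
theorem ae_not_hasInfiniteComponent (x : RootedGraph) {p q : I} (hpq : p < q)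
    (h : infProb q x = 0) :
    ∀ᵐ ω ∂percolation x.graph p, ¬ HasInfiniteComponent (openGraph ω) := by
  classical
  have := x.countable
  have key : ∀ v : x.V, ∀ᵐ ω ∂percolation x.graph p,
      ¬ ∀ k, BigCluster k (openGraph ω) v := by
    intro v
    obtain ⟨s, hs, hU⟩ := exists_sprinkle hpq
    obtain ⟨P⟩ := x.connected.preconnected v x.root
    have hF : ((P.edges.toFinset : Finset (Sym2 x.V)) : Set (Sym2 x.V)) ⊆ x.graph.edgeSet := by
      intro e he
      exact P.edges_subset_edgeSet (by simpa using he)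
    have h0 : percolation x.graph q {ω | ∀ k, BigCluster k (openGraph ω) x.root} = 0 := by
      rwa [infProb, measureReal_eq_zero_iff] at h
    have h1 : ∀ᵐ ω ∂percolation x.graph q, ¬ ∀ k, BigCluster k (openGraph ω) x.root := by
      rw [ae_iff]; simpa using h0
    rw [percolation, ← hU] at h1
    have h2 := ae_of_ae_map measurable_union_pair.aemeasurable h1
    rw [ae_iff] at h2
    have h3 : {ω | ∀ k, BigCluster k (openGraph ω) v} ×ˢ
        {η | ((P.edges.toFinset : Finset (Sym2 x.V)) : Set (Sym2 x.V)) ⊆ η} ⊆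
        {z : Set (Sym2 x.V) × Set (Sym2 x.V) |
          ¬ ¬ ∀ k, BigCluster k (openGraph (z.1 ∪ z.2)) x.root} := by
      rintro ⟨ω, η⟩ ⟨hω, hη⟩
      rw [Set.mem_ofPred_eq, not_not]
      intro k
      refine BigCluster.of_reachable ?_ ((hω k).mono_graph (openGraph_mono Set.subset_union_left))
      have hP : ∀ e ∈ P.edges, e ∈ (openGraph (ω ∪ η)).edgeSet := by
        intro e he
        rw [openGraph, SimpleGraph.edgeSet_fromEdgeSet]
        refine ⟨Or.inr (hη (by simpa using he)), ?_⟩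
        exact x.graph.not_isDiag_of_mem_edgeSet (P.edges_subset_edgeSet he)
      exact ⟨P.transfer _ hP⟩
    have h4 := measure_mono_null h3 h2
    rw [Measure.prod_prod, setBernoulli_superset hF, mul_eq_zero] at h4
    rcases h4 with h4 | h4
    · rw [ae_iff, percolation]; simpa using h4
    · exfalso
      have h5 := eq_zero_of_pow_eq_zero h4
      rw [ENNReal.coe_eq_zero] at h5
      have h6 : (s : ℝ) = 0 := by
        have := congrArg NNReal.toReal h5
        simpa using this
      exact hs.ne' (Subtype.ext h6)
  filter_upwards [ae_all_iff.2 key] with ω hω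
  rintro ⟨C, hC⟩
  induction C using SimpleGraph.ConnectedComponent.ind with
  | _ v =>
    refine hω v (forall_bigCluster_iff.2 ?_)
    convert hC using 1
    ext w
    simp only [Set.mem_ofPred_eq, SimpleGraph.ConnectedComponent.mem_supp_iff,
      SimpleGraph.ConnectedComponent.eq]
    exact SimpleGraph.reachable_comm

theorem not_ae_not_hasInfiniteComponent (x : RootedGraph) {p q : I} (hpq : p < q)
    (h : 0 < infProb p x) :
    ¬ ∀ᵐ ω ∂percolation x.graph q, ¬ HasInfiniteComponent (openGraph ω) := by
  intro hq
  obtain ⟨s, hs, hU⟩ := exists_sprinkle hpq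
  rw [percolation, ← hU] at hq
  have h2 := ae_of_ae_map measurable_union_pair.aemeasurable hq
  rw [ae_iff] at h2
  have h3 : {ω | ∀ k, BigCluster k (openGraph ω) x.root} ×ˢ Set.univ ⊆
      {z : Set (Sym2 x.V) × Set (Sym2 x.V) |
        ¬ ¬ HasInfiniteComponent (openGraph (z.1 ∪ z.2))} := by
    rintro ⟨ω, η⟩ ⟨hω, -⟩
    rw [Set.mem_ofPred_eq, not_not]
    have h4 := forall_bigCluster_iff.1
      fun k => (hω k).mono_graph (openGraph_mono (Set.subset_union_left (t := η)))
    refine ⟨(openGraph (ω ∪ η)).connectedComponentMk x.root, h4.mono fun w hw => ?_⟩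
    exact SimpleGraph.ConnectedComponent.eq.2 (SimpleGraph.Reachable.symm hw)
  have h4 := measure_mono_null h3 h2
  rw [Measure.prod_prod, measure_univ, mul_one] at h4
  refine h.ne' ?_
  rw [infProb, measureReal_def]
  change (ProbabilityTheory.setBernoulli _ _ _).toReal = 0
  rw [h4]; rfl

theorem le_criticalProbability (x : RootedGraph) {p q : I} (hpq : p < q)
    (h : infProb q x = 0) : (p : ℝ) ≤ criticalProbability x.graph :=
  le_csSup ⟨1, fun _ ⟨hr, _⟩ => hr.2⟩ ⟨p.2, x.ae_not_hasInfiniteComponent hpq h⟩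

theorem criticalProbability_le (x : RootedGraph) {p : I} (h : 0 < infProb p x) :
    criticalProbability x.graph ≤ p := by
  refine Real.sSup_le ?_ p.2.1
  rintro r ⟨hr, hr'⟩
  by_contra! hlt
  exact x.not_ae_not_hasInfiniteComponent (p := p) (q := ⟨r, hr⟩) hlt h hr'

theorem criticalProbability_nonneg (x : RootedGraph) : 0 ≤ criticalProbability x.graph :=
  Real.sSup_nonneg fun _ ⟨hr, _⟩ => hr.1

theorem criticalProbability_le_one (x : RootedGraph) : criticalProbability x.graph ≤ 1 :=
  Real.sSup_le (fun _ ⟨hr, _⟩ => hr.2) zero_le_one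

end RootedGraph

/-! ### Local functions and local weak convergence -/

/-- A function of rooted graphs that depends only on the ball of radius `R` around the root. -/
def IsLocal (R : ℕ) (F : RootedGraph → ℝ) : Prop :=
  ∀ x y, RootedGraph.BallIso R x y → F x = F y

namespace RootedGraphSpace

/-- A function of rooted graphs, evaluated at a representative of an isomorphism class. -/
noncomputable def lift (F : RootedGraph → ℝ) (x : RootedGraphSpace) : ℝ := F (Quotient.out x)

theorem lift_mk {R : ℕ} {F : RootedGraph → ℝ} (hF : IsLocal R F) (x : RootedGraph) :
    lift F (mk x) = F x :=
  hF _ _ ((Quotient.mk_out (s := RootedGraph.setoid) x).ballIso R)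

theorem ballIso_out {R : ℕ} {x y : RootedGraphSpace} (h : BallIso R x y) :
    RootedGraph.BallIso R (Quotient.out x) (Quotient.out y) := by
  rw [← Quotient.out_eq x, ← Quotient.out_eq y] at h
  exact h

theorem continuous_lift {R : ℕ} {F : RootedGraph → ℝ} (hF : IsLocal R F) :
    Continuous (lift F) := by
  refine continuous_iff_continuousAt.2 fun x => ?_
  have : ∀ᶠ y in 𝓝 x, lift F x = lift F y := by
    filter_upwards [Metric.ball_mem_nhds x (show (0 : ℝ) < 1 / (1 + (R : ℝ)) by positivity)]
      with y hy
    obtain ⟨R', hR', hlt⟩ := exists_lt_of_localDist_lt (Metric.mem_ball'.1 hy)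
    have : R ≤ R' := by
      by_contra! hlt'
      have h1 : (R' : ℝ) ≤ R := by exact_mod_cast hlt'.le
      have := one_div_le_one_div_of_le (by positivity : (0 : ℝ) < 1 + R')
        (by linarith : (1 : ℝ) + R' ≤ 1 + R)
      linarith
    exact hF _ _ (ballIso_out (hR'.mono this))
  exact tendsto_const_nhds.congr' this

theorem integrable_lift {R : ℕ} {F : RootedGraph → ℝ} (hF : IsLocal R F) {C : ℝ}
    (hC : ∀ x, |F x| ≤ C) (μ : Measure RootedGraphSpace) [IsFiniteMeasure μ] :
    Integrable (lift F) μ :=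
  Integrable.of_bound (continuous_lift hF).aestronglyMeasurable C (ae_of_all _ fun _ => hC _)

end RootedGraphSpace

open RootedGraphSpace

theorem integral_localLaw {V : Type} [Fintype V] [Nonempty V] (G : SimpleGraph V) {R : ℕ}
    {F : RootedGraph → ℝ} (hF : IsLocal R F) :
    ∫ x, lift F x ∂(localLaw G : Measure RootedGraphSpace) =
      (∑ v, F (rootedComponent G v)) / Fintype.card V := by
  let _ : MeasurableSpace V := ⊤
  change ∫ x, lift F x ∂((PMF.uniformOfFintype V).map
    fun v => RootedGraphSpace.mk (rootedComponent G v)).toMeasure = _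
  have hm : Measurable fun v : V => RootedGraphSpace.mk (rootedComponent G v) := fun _ _ => trivial
  rw [← PMF.toMeasure_map _ _ hm, integral_map hm.aemeasurable
    (continuous_lift hF).aestronglyMeasurable, PMF.integral_eq_sum]
  simp only [lift_mk hF, PMF.uniformOfFintype_apply, ENNReal.toReal_inv, ENNReal.toReal_natCast,
    smul_eq_mul, ← Finset.mul_sum]
  rw [div_eq_inv_mul]

/-- Averages over the vertices of a bounded local function converge. -/
theorem LocallyWeaklyConverges.tendsto_average {V : ℕ → Type} [∀ n, Fintype (V n)]
    [∀ n, Nonempty (V n)] {G : ∀ n, SimpleGraph (V n)} {μ : ProbabilityMeasure RootedGraphSpace}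
    (hμ : LocallyWeaklyConverges G μ) {R : ℕ} {F : RootedGraph → ℝ} (hF : IsLocal R F) {C : ℝ}
    (hC : ∀ x, |F x| ≤ C) :
    Tendsto (fun n => (∑ v, F (rootedComponent (G n) v)) / Fintype.card (V n)) atTop
      (𝓝 (∫ x, lift F x ∂(μ : Measure RootedGraphSpace))) := by
  have h := ProbabilityMeasure.tendsto_iff_forall_integral_tendsto.1 hμ
    (BoundedContinuousFunction.ofNormedAddCommGroup (lift F) (continuous_lift hF) C fun x => hC _)
  exact h.congr fun n => integral_localLaw (G n) hF

theorem isLocal_bigProb (k : ℕ) (p : I) : IsLocal k (RootedGraph.bigProb k p) :=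
  fun _ _ h => h.bigProb_eq p

theorem abs_bigProb_le (k : ℕ) (p : I) (x : RootedGraph) : |RootedGraph.bigProb k p x| ≤ 1 := by
  rw [abs_of_nonneg (RootedGraph.bigProb_nonneg k p x)]
  exact RootedGraph.bigProb_le_one k p x

/-- The probability that the cluster of the root of a random rooted graph is infinite. -/
noncomputable def percolationProb (μ : ProbabilityMeasure RootedGraphSpace) (p : I) : ℝ :=
  ∫ x, lift (RootedGraph.infProb p) x ∂(μ : Measure RootedGraphSpace)

theorem measurable_lift_infProb (p : I) : Measurable (lift (RootedGraph.infProb p)) :=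
  measurable_of_tendsto_metrizable (fun k => (continuous_lift (isLocal_bigProb k p)).measurable)
    (tendsto_pi_nhds.2 fun x => RootedGraph.tendsto_bigProb p (Quotient.out x))

theorem lift_infProb_nonneg (p : I) (x : RootedGraphSpace) :
    0 ≤ lift (RootedGraph.infProb p) x := measureReal_nonneg

theorem integrable_lift_infProb (p : I) (μ : ProbabilityMeasure RootedGraphSpace) :
    Integrable (lift (RootedGraph.infProb p)) (μ : Measure RootedGraphSpace) :=
  Integrable.of_bound (measurable_lift_infProb p).aestronglyMeasurable 1 (ae_of_all _ fun x => by
    rw [Real.norm_of_nonneg (lift_infProb_nonneg p x)]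
    exact measureReal_le_one)

theorem tendsto_integral_bigProb (μ : ProbabilityMeasure RootedGraphSpace) (p : I) :
    Tendsto (fun k => ∫ x, lift (RootedGraph.bigProb k p) x ∂(μ : Measure RootedGraphSpace)) atTop
      (𝓝 (percolationProb μ p)) :=
  tendsto_integral_of_dominated_convergence (fun _ => 1)
    (fun k => (continuous_lift (isLocal_bigProb k p)).aestronglyMeasurable)
    (integrable_const _) (fun k => ae_of_all _ fun _ => abs_bigProb_le k p _)
    (ae_of_all _ fun x => RootedGraph.tendsto_bigProb p (Quotient.out x))

theorem percolationProb_le (μ : ProbabilityMeasure RootedGraphSpace) (p : I) (k : ℕ) :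
    percolationProb μ p ≤
      ∫ x, lift (RootedGraph.bigProb k p) x ∂(μ : Measure RootedGraphSpace) :=
  integral_mono (integrable_lift_infProb p μ)
    (integrable_lift (isLocal_bigProb k p) (abs_bigProb_le k p) _)
    fun _ => RootedGraph.infProb_le_bigProb k p _

theorem ae_infProb_eq_zero {μ : ProbabilityMeasure RootedGraphSpace} {p : I}
    (h : percolationProb μ p = 0) :
    ∀ᵐ x ∂(μ : Measure RootedGraphSpace), lift (RootedGraph.infProb p) x = 0 :=
  (integral_eq_zero_iff_of_nonneg (lift_infProb_nonneg p) (integrable_lift_infProb p μ)).1 h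

theorem percolationProb_nonneg (μ : ProbabilityMeasure RootedGraphSpace) (p : I) :
    0 ≤ percolationProb μ p := integral_nonneg (lift_infProb_nonneg p)

theorem RootedGraphSpace.criticalProbability_eq_out (x : RootedGraphSpace) :
    x.criticalProbability = _root_.criticalProbability (Quotient.out x).graph := by
  conv_lhs => rw [← Quotient.out_eq x]
  rfl

/-! ### Edge cuts and short paths in finite graphs -/

section Cuts

variable {V : Type}

/-- The number of edges of `G` that leave the vertex set `S`. -/
noncomputable def cutSize (G : SimpleGraph V) (S : Set V) : ℕ := (edgesBetween G S Sᶜ).ncard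

theorem mem_edgesBetween_compl {G : SimpleGraph V} {S : Set V} {e : Sym2 V} :
    e ∈ edgesBetween G S Sᶜ ↔ ∃ a b, a ∈ S ∧ b ∉ S ∧ G.Adj a b ∧ e = s(a, b) := by
  constructor
  · rintro ⟨he, a, ha, b, hb, rfl⟩
    exact ⟨a, b, ha, hb, he, rfl⟩
  · rintro ⟨a, b, ha, hb, hab, rfl⟩
    exact ⟨hab, a, ha, b, hb, rfl⟩

theorem cutSize_compl (G : SimpleGraph V) (S : Set V) : cutSize G Sᶜ = cutSize G S := by
  unfold cutSize
  congr 1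
  ext e
  rw [mem_edgesBetween_compl, mem_edgesBetween_compl]
  constructor
  · rintro ⟨a, b, ha, hb, hab, rfl⟩
    exact ⟨b, a, not_not.1 hb, ha, hab.symm, Sym2.eq_swap⟩
  · rintro ⟨a, b, ha, hb, hab, rfl⟩
    exact ⟨b, a, hb, not_not.2 ha, hab.symm, Sym2.eq_swap⟩

/-- If all cuts that separate `A` from `B` have at least `t` edges, and there are fewer than `L * t`
edges, then some path of length at most `L` joins `A` to `B`: otherwise the boundaries of the first
`L` neighborhoods of `A` would be disjoint such cuts. -/
theorem exists_short_walk [Finite V] {K : SimpleGraph V} {A B : Set V} {L t : ℕ}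
    (hcut : ∀ S : Set V, A ⊆ S → Disjoint S B → t ≤ cutSize K S)
    (hE : K.edgeSet.ncard < L * t) :
    ∃ a ∈ A, ∃ b ∈ B, ∃ p : K.Walk a b, p.length ≤ L := by
  classical
  by_contra! hno
  let S : ℕ → Set V := fun i => {w | ∃ a ∈ A, ∃ p : K.Walk a w, p.length ≤ i}
  have hSmono : Monotone S := fun i j hij w ⟨a, ha, p, hp⟩ => ⟨a, ha, p, hp.trans hij⟩
  have hstep : ∀ i a b, a ∈ S i → K.Adj a b → b ∈ S (i + 1) := by
    rintro i a b ⟨a₀, ha₀, p, hp⟩ hab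
    exact ⟨a₀, ha₀, p.concat hab, by rw [SimpleGraph.Walk.length_concat]; omega⟩
  -- An edge leaving `S i` lies inside `S (i + 1)`, so it cannot leave a later neighborhood.
  let T : ℕ → Finset (Sym2 V) := fun i => (Set.toFinite (edgesBetween K (S i) (S i)ᶜ)).toFinset
  have hT : ∀ i < L, t ≤ (T i).card := by
    intro i hi
    rw [← Set.ncard_eq_toFinset_card]
    refine hcut (S i) (fun a ha => ⟨a, ha, .nil, by simp⟩) ?_
    rw [Set.disjoint_left]
    rintro b ⟨a, ha, p, hp⟩ hb
    have := hno a ha b hb p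
    omega
  have hdisj : ∀ i j, i < j → Disjoint (T i) (T j) := by
    intro i j hij
    rw [Finset.disjoint_left]
    intro e he he'
    simp only [T, Set.Finite.mem_toFinset, mem_edgesBetween_compl] at he he'
    obtain ⟨a, b, ha, -, hab, rfl⟩ := he
    obtain ⟨c, d, -, hd, -, hcd⟩ := he'
    have h1 : a ∈ S j := hSmono hij.le ha
    have h2 : b ∈ S j := hSmono hij (hstep i a b ha hab)
    rw [Sym2.eq_iff] at hcd
    rcases hcd with ⟨-, rfl⟩ | ⟨rfl, -⟩
    · exact hd h2
    · exact hd h1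
  have hsum : L * t ≤ ((Finset.range L).biUnion T).card := by
    rw [Finset.card_biUnion]
    · calc L * t = ∑ _i ∈ Finset.range L, t := by simp
        _ ≤ _ := Finset.sum_le_sum fun i hi => hT i (Finset.mem_range.1 hi)
    · intro i _ j _ hij
      rcases lt_or_gt_of_ne hij with h | h
      · exact hdisj i j h
      · exact (hdisj j i h).symm
  have hle : ((Finset.range L).biUnion T).card ≤ K.edgeSet.ncard := by
    rw [← Set.ncard_coe_finset]
    refine Set.ncard_le_ncard ?_
    intro e he
    simp only [Finset.coe_biUnion, Set.mem_iUnion, Finset.mem_coe, T, Set.Finite.mem_toFinset] at he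
    obtain ⟨i, -, he⟩ := he
    exact he.1
  omega

/-- Some open path joins `A` to `B`. -/
def OpenJoined (ω : Set (Sym2 V)) (A B : Set V) : Prop :=
  ∃ a ∈ A, ∃ b ∈ B, (openGraph ω).Reachable a b

theorem OpenJoined.mono {ω ω' : Set (Sym2 V)} (h : ω ⊆ ω') {A B : Set V} (hj : OpenJoined ω A B) :
    OpenJoined ω' A B := by
  obtain ⟨a, ha, b, hb, hab⟩ := hj
  exact ⟨a, ha, b, hb, hab.mono (openGraph_mono h)⟩

theorem reachable_openGraph_of_walk {K : SimpleGraph V} {a b : V} (p : K.Walk a b)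
    {ω : Set (Sym2 V)} (h : ∀ e ∈ p.edges, e ∈ ω) : (openGraph ω).Reachable a b := by
  refine ⟨p.transfer _ fun e he => ?_⟩
  rw [openGraph, SimpleGraph.edgeSet_fromEdgeSet]
  exact ⟨h e he, K.not_isDiag_of_mem_edgeSet (p.edges_subset_edgeSet he)⟩

theorem percolation_real_superset {K : SimpleGraph V} {F : Finset (Sym2 V)}
    (hF : (F : Set (Sym2 V)) ⊆ K.edgeSet) (s : I) :
    (percolation K s).real {ω | (F : Set (Sym2 V)) ⊆ ω} = (s : ℝ) ^ F.card := by
  rw [measureReal_def, percolation, setBernoulli_superset hF]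
  simp

/-- If the cuts that separate `A` from `B` have at least `t + j * L` edges and there are fewer than
`L * t` edges, then one can successively find `j` edge-disjoint paths of length at most `L`, all of
which are closed with probability at most `(1 - s ^ L) ^ j`. -/
theorem percolation_not_joined_le [Finite V] {A B : Set V} {L t : ℕ} (s : I) (j : ℕ) :
    ∀ K : SimpleGraph V, K.edgeSet.ncard < L * t →
      (∀ S : Set V, A ⊆ S → Disjoint S B → t + j * L ≤ cutSize K S) →
      (percolation K s).real {ω | ¬ OpenJoined ω A B} ≤ (1 - (s : ℝ) ^ L) ^ j := by
  classical
  have hs0 : (0 : ℝ) ≤ s := s.2.1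
  have hs1 : (s : ℝ) ≤ 1 := s.2.2
  induction j with
  | zero => intro K _ _; simp
  | succ j ih =>
    intro K hE hcut
    obtain ⟨a, ha, b, hb, p, hp⟩ := exists_short_walk
      (fun S hAS hSB => le_trans (by omega) (hcut S hAS hSB)) hE
    let F : Finset (Sym2 V) := p.edges.toFinset
    have hFK : (F : Set (Sym2 V)) ⊆ K.edgeSet := by
      intro e he
      exact p.edges_subset_edgeSet (by simpa [F] using he)
    have hFL : F.card ≤ L := by
      refine (List.toFinset_card_le _).trans ?_
      rwa [SimpleGraph.Walk.length_edges]
    have hK' : (K.deleteEdges F).edgeSet = K.edgeSet \ F := SimpleGraph.edgeSet_deleteEdges _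
    have h1 : (percolation (K.deleteEdges F) s).real {ω | ¬ OpenJoined ω A B} ≤
        (1 - (s : ℝ) ^ L) ^ j := by
      refine ih _ (lt_of_le_of_lt ?_ hE) fun S hAS hSB => ?_
      · rw [hK']; exact Set.ncard_le_ncard Set.sdiff_subset
      · have h2 := hcut S hAS hSB
        have h3 : edgesBetween K S Sᶜ ⊆ edgesBetween (K.deleteEdges F) S Sᶜ ∪ F := by
          intro e he
          by_cases heF : e ∈ F
          · exact Or.inr heF
          · exact Or.inl ⟨by rw [hK']; exact ⟨he.1, heF⟩, he.2⟩
        have h4 := (Set.ncard_le_ncard h3).trans (Set.ncard_union_le _ _)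
        rw [Set.ncard_coe_finset] at h4
        unfold cutSize at h2 ⊢
        rw [Nat.add_mul] at h2
        omega
    have hU := setBernoulli_prod_map_union_of_disjoint
      (Set.disjoint_sdiff_right : Disjoint (F : Set (Sym2 V)) (K.edgeSet \ F)) s
    rw [Set.union_sdiff_cancel hFK] at hU
    have h5 : (percolation K s).real {ω | ¬ OpenJoined ω A B} ≤
        ((ProbabilityTheory.setBernoulli (F : Set (Sym2 V)) s).prod
          (ProbabilityTheory.setBernoulli (K.edgeSet \ F) s)).real
          ({ω | (F : Set (Sym2 V)) ⊆ ω}ᶜ ×ˢ {ω | ¬ OpenJoined ω A B}) := by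
      rw [percolation, ← hU, map_measureReal_apply measurable_union_pair (measurableSet_of_finite _)]
      refine measureReal_mono ?_
      rintro ⟨ω, η⟩ h
      refine ⟨fun hFω => h ⟨a, ha, b, hb, ?_⟩, fun hj => h (hj.mono Set.subset_union_right)⟩
      exact reachable_openGraph_of_walk p fun e he => Or.inl (hFω (by simpa [F] using he))
    refine h5.trans ?_
    rw [measureReal_prod_prod, pow_succ', ← hK']
    have h6 : (ProbabilityTheory.setBernoulli (F : Set (Sym2 V)) s).real
        {ω | (F : Set (Sym2 V)) ⊆ ω} = (s : ℝ) ^ F.card := by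
      rw [measureReal_def, setBernoulli_superset subset_rfl]
      simp
    rw [probReal_compl_eq_one_sub (measurableSet_of_finite _), h6]
    have h7 : (s : ℝ) ^ L ≤ (s : ℝ) ^ F.card := pow_le_pow_of_le_one hs0 hs1 hFL
    have h8 : (s : ℝ) ^ L ≤ 1 := pow_le_one₀ hs0 hs1
    exact mul_le_mul (by linarith) h1 measureReal_nonneg (by linarith)

theorem percolation_not_joined_mono [Finite V] {K G : SimpleGraph V} (h : K ≤ G) (s : I)
    (A B : Set V) :
    (percolation G s).real {ω | ¬ OpenJoined ω A B} ≤
      (percolation K s).real {ω | ¬ OpenJoined ω A B} := by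
  have hKG : K.edgeSet ⊆ G.edgeSet := SimpleGraph.edgeSet_mono h
  have hU := setBernoulli_prod_map_union_of_disjoint
    (Set.disjoint_sdiff_right : Disjoint K.edgeSet (G.edgeSet \ K.edgeSet)) s
  rw [Set.union_sdiff_cancel hKG] at hU
  rw [percolation, ← hU, map_measureReal_apply measurable_union_pair (measurableSet_of_finite _)]
  refine (measureReal_mono (s₂ := {ω | ¬ OpenJoined ω A B} ×ˢ Set.univ) ?_).trans ?_
  · rintro ⟨ω, η⟩ h
    exact ⟨fun hj => h (hj.mono Set.subset_union_left), trivial⟩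
  · rw [measureReal_prod_prod]
    simp [percolation]

end Cuts

/-! ### Expansion after the removal of vertices of large degree -/

/-- The number of neighbors of a vertex. -/
noncomputable def vertexDegree {V : Type} (G : SimpleGraph V) (v : V) : ℕ := (G.neighborSet v).ncard

/-- The vertex has at most `M` neighbors, one of which has more than `M` neighbors. -/
def NearHighDegree {V : Type} (G : SimpleGraph V) (M : ℕ) (v : V) : Prop :=
  vertexDegree G v ≤ M ∧ ∃ w, G.Adj v w ∧ M < vertexDegree G w

open Classical in
/-- The degree of a vertex that has at most `M` neighbors, one of which has more than `M`
neighbors, and `0` at all other vertices. This bounds the number of edges from the vertex to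
vertices of degree more than `M`. -/
noncomputable def nearHighDegree {V : Type} (G : SimpleGraph V) (M : ℕ) (v : V) : ℕ :=
  if NearHighDegree G M v then vertexDegree G v else 0

open Classical in
/-- The indicator function of having more than `M` neighbors. -/
noncomputable def highDegree {V : Type} (G : SimpleGraph V) (M : ℕ) (v : V) : ℕ :=
  if M < vertexDegree G v then 1 else 0

theorem vertexDegree_comap {V W : Type} {G : SimpleGraph V} {K : SimpleGraph W} {f : W → V}
    (hf : f.Injective) (hK : ∀ a b, K.Adj a b ↔ G.Adj (f a) (f b)) {w : W}
    (hw : ∀ u, G.Adj (f w) u → u ∈ Set.range f) : vertexDegree G (f w) = vertexDegree K w := by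
  have : G.neighborSet (f w) = f '' K.neighborSet w := by
    ext u
    simp only [SimpleGraph.mem_neighborSet, Set.mem_image, hK]
    constructor
    · intro h
      obtain ⟨u, rfl⟩ := hw u h
      exact ⟨u, h, rfl⟩
    · rintro ⟨u, h, rfl⟩
      exact h
  rw [vertexDegree, this, Set.ncard_image_of_injective _ hf, vertexDegree]

theorem nearHighDegree_comap {V W : Type} {G : SimpleGraph V} {K : SimpleGraph W} {f : W → V}
    (hf : f.Injective) (hK : ∀ a b, K.Adj a b ↔ G.Adj (f a) (f b)) {w : W}
    (hw : ∀ u, G.Adj (f w) u → u ∈ Set.range f)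
    (hw' : ∀ u u', G.Adj (f w) u → G.Adj u u' → u' ∈ Set.range f) (M : ℕ) :
    nearHighDegree G M (f w) = nearHighDegree K M w := by
  have h1 := vertexDegree_comap hf hK hw
  have h2 : NearHighDegree G M (f w) ↔ NearHighDegree K M w := by
    unfold NearHighDegree
    rw [h1]
    refine and_congr_right fun _ => ⟨?_, ?_⟩
    · rintro ⟨u, hu, hM⟩
      obtain ⟨u, rfl⟩ := hw u hu
      rw [vertexDegree_comap hf hK fun u' => hw' _ u' hu] at hM
      exact ⟨u, (hK _ _).2 hu, hM⟩
    · rintro ⟨u, hu, hM⟩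
      rw [← vertexDegree_comap hf hK fun u' => hw' _ u' ((hK _ _).1 hu)] at hM
      exact ⟨f u, (hK _ _).1 hu, hM⟩
  unfold nearHighDegree
  by_cases h : NearHighDegree K M w
  · rw [if_pos h, if_pos (h2.2 h), h1]
  · rw [if_neg h, if_neg (mt h2.1 h)]

namespace RootedGraph

theorem mem_ball_one_of_adj (x : RootedGraph) {u : x.V} (h : x.graph.Adj x.root u) :
    u ∈ x.ball 1 := x.mem_ball_of_walk ⟨h.toWalk, by simp⟩

theorem mem_ball_two_of_adj (x : RootedGraph) {u u' : x.V} (h : x.graph.Adj x.root u)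
    (h' : x.graph.Adj u u') : u' ∈ x.ball 2 :=
  x.mem_ball_of_walk ⟨.cons h h'.toWalk, by simp⟩

theorem ball_mono (x : RootedGraph) {R S : ℕ} (h : R ≤ S) : x.ball R ⊆ x.ball S :=
  fun _ hw => le_trans hw h

end RootedGraph

theorem isLocal_vertexDegree :
    IsLocal 1 fun x => (vertexDegree x.graph x.root : ℝ) := by
  rintro x y ⟨φ, hφ⟩
  have h1 := vertexDegree_comap (G := x.graph) (K := x.ballGraph 1) (f := Subtype.val)
    Subtype.val_injective (fun _ _ => Iff.rfl) (w := ⟨x.root, x.root_mem_ball 1⟩)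
    (fun u hu => ⟨⟨u, x.mem_ball_one_of_adj hu⟩, rfl⟩)
  have h2 := vertexDegree_comap (G := y.graph) (K := x.ballGraph 1) (f := fun w => (φ w).1)
    (Subtype.val_injective.comp φ.injective) (fun a b => (φ.map_adj_iff (v := a) (w := b)).symm)
    (w := ⟨x.root, x.root_mem_ball 1⟩) (fun u hu => by
      rw [hφ] at hu
      exact ⟨φ.symm ⟨u, y.mem_ball_one_of_adj hu⟩, by simp⟩)
  rw [hφ] at h2
  simp only at h1 h2 ⊢
  rw [h1, h2]

theorem isLocal_highDegree (M : ℕ) : IsLocal 1 fun x => (highDegree x.graph M x.root : ℝ) := by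
  intro x y h
  have := isLocal_vertexDegree x y h
  simp only [Nat.cast_inj] at this
  simp only [highDegree, this]

theorem isLocal_nearHighDegree (M : ℕ) :
    IsLocal 2 fun x => (nearHighDegree x.graph M x.root : ℝ) := by
  rintro x y ⟨φ, hφ⟩
  have h1 := nearHighDegree_comap (G := x.graph) (K := x.ballGraph 2) (f := Subtype.val)
    Subtype.val_injective (fun _ _ => Iff.rfl) (w := ⟨x.root, x.root_mem_ball 2⟩)
    (fun u hu => ⟨⟨u, x.ball_mono one_le_two (x.mem_ball_one_of_adj hu)⟩, rfl⟩)
    (fun u u' hu hu' => ⟨⟨u', x.mem_ball_two_of_adj hu hu'⟩, rfl⟩) M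
  have h2 := nearHighDegree_comap (G := y.graph) (K := x.ballGraph 2) (f := fun w => (φ w).1)
    (Subtype.val_injective.comp φ.injective) (fun a b => (φ.map_adj_iff (v := a) (w := b)).symm)
    (w := ⟨x.root, x.root_mem_ball 2⟩) (fun u hu => by
      rw [hφ] at hu
      exact ⟨φ.symm ⟨u, y.ball_mono one_le_two (y.mem_ball_one_of_adj hu)⟩, by simp⟩)
    (fun u u' hu hu' => by
      rw [hφ] at hu
      exact ⟨φ.symm ⟨u', y.mem_ball_two_of_adj hu hu'⟩, by simp⟩) M
  rw [hφ] at h2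
  simp only at h1 h2 ⊢
  rw [h1, h2]

section Component

variable {V : Type} (G : SimpleGraph V) (v : V)

theorem mem_range_component {u : V} (h : G.Reachable v u) :
    u ∈ Set.range (Subtype.val : (G.connectedComponentMk v) → V) :=
  ⟨⟨u, (SimpleGraph.ConnectedComponent.eq.2 h).symm⟩, rfl⟩

variable [Finite V]

theorem vertexDegree_rootedComponent :
    vertexDegree (rootedComponent G v).graph (rootedComponent G v).root = vertexDegree G v :=
  (vertexDegree_comap (G := G) (K := (G.connectedComponentMk v).toSimpleGraph)
    (f := Subtype.val) Subtype.val_injective (fun _ _ => Iff.rfl)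
    (w := ⟨v, SimpleGraph.ConnectedComponent.connectedComponentMk_mem⟩)
    fun _ hu => mem_range_component G v hu.reachable).symm

theorem highDegree_rootedComponent (M : ℕ) :
    highDegree (rootedComponent G v).graph M (rootedComponent G v).root = highDegree G M v := by
  simp only [highDegree, vertexDegree_rootedComponent]

theorem nearHighDegree_rootedComponent (M : ℕ) :
    nearHighDegree (rootedComponent G v).graph M (rootedComponent G v).root =
      nearHighDegree G M v :=
  (nearHighDegree_comap (G := G) (K := (G.connectedComponentMk v).toSimpleGraph)
    (f := Subtype.val) Subtype.val_injective (fun _ _ => Iff.rfl)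
    (w := ⟨v, SimpleGraph.ConnectedComponent.connectedComponentMk_mem⟩)
    (fun _ hu => mem_range_component G v hu.reachable)
    (fun _ _ hu hu' => mem_range_component G v (hu.reachable.trans hu'.reachable)) M).symm

end Component

section Limits

variable {μ : ProbabilityMeasure RootedGraphSpace}

open RootedGraphSpace

theorem RootedGraphSpace.rootDegree_eq_out (x : RootedGraphSpace) :
    (x.rootDegree : ℝ) = lift (fun x => (vertexDegree x.graph x.root : ℝ)) x := by
  conv_lhs => rw [← Quotient.out_eq x]
  rfl

theorem integrable_vertexDegree
    (hdeg : ∫⁻ x, (x.rootDegree : ℝ≥0∞) ∂(μ : Measure RootedGraphSpace) < ∞) :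
    Integrable (lift fun x => (vertexDegree x.graph x.root : ℝ))
      (μ : Measure RootedGraphSpace) := by
  refine ⟨(continuous_lift isLocal_vertexDegree).aestronglyMeasurable, ?_⟩
  rw [hasFiniteIntegral_iff_enorm]
  refine lt_of_eq_of_lt (lintegral_congr fun x => ?_) hdeg
  rw [← rootDegree_eq_out]
  simp

theorem nearHighDegree_le {V : Type} (G : SimpleGraph V) (M : ℕ) (v : V) :
    nearHighDegree G M v ≤ vertexDegree G v := by
  unfold nearHighDegree; split <;> omega

theorem nearHighDegree_le' {V : Type} (G : SimpleGraph V) (M : ℕ) (v : V) :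
    nearHighDegree G M v ≤ M := by
  unfold nearHighDegree
  split
  · rename_i h; exact h.1
  · omega

theorem highDegree_le_one {V : Type} (G : SimpleGraph V) (M : ℕ) (v : V) :
    highDegree G M v ≤ 1 := by
  unfold highDegree; split <;> omega

theorem tendsto_integral_nearHighDegree
    (hdeg : ∫⁻ x, (x.rootDegree : ℝ≥0∞) ∂(μ : Measure RootedGraphSpace) < ∞) :
    Tendsto (fun M => ∫ x, lift (fun x => (nearHighDegree x.graph M x.root : ℝ)) x
      ∂(μ : Measure RootedGraphSpace)) atTop (𝓝 0) := by
  have h := tendsto_integral_of_dominated_convergence (μ := (μ : Measure RootedGraphSpace))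
    (F := fun M => lift fun x => (nearHighDegree x.graph M x.root : ℝ)) (f := fun _ => 0)
    (lift fun x => (vertexDegree x.graph x.root : ℝ))
    (fun M => (continuous_lift (isLocal_nearHighDegree M)).aestronglyMeasurable)
    (integrable_vertexDegree hdeg) (fun M => ae_of_all _ fun x => ?_) (ae_of_all _ fun x => ?_)
  · simpa using h
  · simp only [lift, Real.norm_natCast, Nat.cast_le]
    exact nearHighDegree_le _ _ _
  · simp only [lift]
    refine tendsto_const_nhds.congr' ?_
    obtain ⟨N, hN⟩ := ((Quotient.out x).locallyFinite (Quotient.out x).root).image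
      (vertexDegree (Quotient.out x).graph) |>.bddAbove
    filter_upwards [eventually_ge_atTop N] with M hM
    rw [nearHighDegree, if_neg, Nat.cast_zero]
    rintro ⟨-, w, hw, hlt⟩
    have := hN ⟨w, hw, rfl⟩
    omega

theorem tendsto_integral_highDegree :
    Tendsto (fun M => ∫ x, lift (fun x => (highDegree x.graph M x.root : ℝ)) x
      ∂(μ : Measure RootedGraphSpace)) atTop (𝓝 0) := by
  have h := tendsto_integral_of_dominated_convergence (μ := (μ : Measure RootedGraphSpace))
    (F := fun M => lift fun x => (highDegree x.graph M x.root : ℝ)) (f := fun _ => 0)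
    (fun _ => 1)
    (fun M => (continuous_lift (isLocal_highDegree M)).aestronglyMeasurable)
    (integrable_const _) (fun M => ae_of_all _ fun x => ?_) (ae_of_all _ fun x => ?_)
  · simpa using h
  · simp only [lift, Real.norm_natCast]
    exact_mod_cast highDegree_le_one (Quotient.out x).graph M (Quotient.out x).root
  · simp only [lift]
    refine tendsto_const_nhds.congr' ?_
    filter_upwards [eventually_ge_atTop (vertexDegree (Quotient.out x).graph (Quotient.out x).root)]
      with M hM
    rw [highDegree, if_neg (by omega), Nat.cast_zero]

end Limits

/-- The subgraph of the edges both of whose endpoints have degree at most `M`. -/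
def lowDegreeGraph {V : Type} (G : SimpleGraph V) (M : ℕ) : SimpleGraph V where
  Adj a b := G.Adj a b ∧ vertexDegree G a ≤ M ∧ vertexDegree G b ≤ M
  symm := ⟨fun _ _ h => ⟨h.1.symm, h.2.2, h.2.1⟩⟩
  loopless := ⟨fun _ h => h.1.ne rfl⟩

theorem lowDegreeGraph_le {V : Type} (G : SimpleGraph V) (M : ℕ) : lowDegreeGraph G M ≤ G :=
  fun _ _ h => h.1

section FiniteGraph

variable {V : Type} [Fintype V] (G : SimpleGraph V)

/-- The edges at a set of vertices are at most as many as the sum of the degrees. -/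
theorem ncard_edges_at_le (P : V → Prop) [DecidablePred P] :
    {e | ∃ a b, P a ∧ G.Adj a b ∧ e = s(a, b)}.ncard ≤ ∑ v, if P v then vertexDegree G v else 0 := by
  have h : {e | ∃ a b, P a ∧ G.Adj a b ∧ e = s(a, b)} ⊆
      ⋃ v : V, if P v then (fun w => s(v, w)) '' G.neighborSet v else ∅ := by
    rintro _ ⟨a, b, ha, hab, rfl⟩
    refine Set.mem_iUnion.2 ⟨a, ?_⟩
    rw [if_pos ha]
    exact ⟨b, hab, rfl⟩
  refine (Set.ncard_le_ncard h).trans ((Set.ncard_iUnion_le_of_fintype _).trans ?_)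
  refine Finset.sum_le_sum fun v _ => ?_
  split
  · exact Set.ncard_image_le
  · simp

theorem ncard_edgeSet_lowDegreeGraph_le (M : ℕ) :
    (lowDegreeGraph G M).edgeSet.ncard ≤ M * Fintype.card V := by
  classical
  have h : (lowDegreeGraph G M).edgeSet ⊆
      {e | ∃ a b, vertexDegree G a ≤ M ∧ G.Adj a b ∧ e = s(a, b)} := by
    intro e he
    induction e using Sym2.ind with
    | _ a b => exact ⟨a, b, he.2.1, he.1, rfl⟩
  refine (Set.ncard_le_ncard h).trans ((ncard_edges_at_le G _).trans ?_)
  refine (Finset.sum_le_card_nsmul _ _ M fun v _ => ?_).trans ?_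
  · split <;> omega
  · simp [mul_comm]

/-- Edges that leave `S` after the vertices of large degree are removed from it either leave `S` in
the truncated graph, or lead to a vertex of large degree. -/
theorem cutSize_sdiff_le (M : ℕ) (S : Set V) :
    cutSize G (S \ {v | M < vertexDegree G v}) ≤
      cutSize (lowDegreeGraph G M) S + ∑ v, nearHighDegree G M v := by
  classical
  have h : edgesBetween G (S \ {v | M < vertexDegree G v}) (S \ {v | M < vertexDegree G v})ᶜ ⊆
      edgesBetween (lowDegreeGraph G M) S Sᶜ ∪
        {e | ∃ a b, NearHighDegree G M a ∧ G.Adj a b ∧ e = s(a, b)} := by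
    intro e he
    rw [mem_edgesBetween_compl] at he
    obtain ⟨a, b, ⟨haS, haM⟩, hb, hab, rfl⟩ := he
    have haM' : vertexDegree G a ≤ M := not_lt.1 haM
    by_cases hbM : M < vertexDegree G b
    · exact Or.inr ⟨a, b, ⟨haM', b, hab, hbM⟩, hab, rfl⟩
    · refine Or.inl (mem_edgesBetween_compl.2 ⟨a, b, haS, fun hbS => hb ⟨hbS, hbM⟩,
        ⟨hab, haM', not_lt.1 hbM⟩, rfl⟩)
  refine (Set.ncard_le_ncard h).trans ((Set.ncard_union_le _ _).trans ?_)
  exact Nat.add_le_add_left (ncard_edges_at_le G _) _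

theorem sum_highDegree (M : ℕ) : ∑ v, highDegree G M v = {v | M < vertexDegree G v}.ncard := by
  classical
  simp only [highDegree, Finset.sum_boole]
  rw [← Set.ncard_coe_finset]
  simp

theorem ncard_compl_add (S : Set V) : S.ncard + Sᶜ.ncard = Fintype.card V := by
  rw [Set.ncard_add_ncard_compl, Nat.card_eq_fintype_card]

/-- The expansion constant concerns sets of at most half of the vertices; passing to complements,
it bounds all cuts with two large sides. -/
theorem le_cutSize_of_le_expansionConstant [Nonempty V] {δ c : ℝ} (hc : 0 ≤ c)
    (h : ENNReal.ofReal c ≤ expansionConstant δ G) {S : Set V}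
    (h1 : δ * Fintype.card V ≤ S.ncard) (h2 : δ * Fintype.card V ≤ (Sᶜ).ncard) :
    c * (δ * Fintype.card V) ≤ cutSize G S := by
  classical
  have hn : (0 : ℝ) < Fintype.card V := by exact_mod_cast Fintype.card_pos
  have key : ∀ T : Set V, δ * Fintype.card V ≤ T.ncard → 2 * T.ncard ≤ Fintype.card V →
      c * (δ * Fintype.card V) ≤ cutSize G T := by
    intro T hT hT2
    rcases Nat.eq_zero_or_pos T.ncard with h0 | hpos
    · rw [h0, Nat.cast_zero] at hT
      exact (mul_nonpos_of_nonneg_of_nonpos hc hT).trans (Nat.cast_nonneg _)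
    have hcard : T.toFinset.card = T.ncard := (Set.ncard_eq_toFinset_card' T).symm
    have h3 : ENNReal.ofReal c ≤ (cutSize G T : ℝ≥0∞) / (T.ncard : ℝ≥0∞) := by
      refine h.trans (iInf₂_le_of_le T.toFinset ?_ ?_)
      · rw [hcard, le_div_iff₀ hn, div_le_iff₀ hn]
        refine ⟨hT, ?_⟩
        have : (2 * T.ncard : ℝ) ≤ Fintype.card V := by exact_mod_cast hT2
        linarith
      · rw [hcard, Set.coe_toFinset]; rfl
    rw [ENNReal.le_div_iff_mul_le (Or.inl (by exact_mod_cast hpos.ne')) (Or.inl (by simp)),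
      ← ENNReal.ofReal_natCast, ← ENNReal.ofReal_mul hc, ← ENNReal.ofReal_natCast,
      ENNReal.ofReal_le_ofReal_iff (Nat.cast_nonneg _)] at h3
    exact (mul_le_mul_of_nonneg_left hT hc).trans h3
  have hadd := ncard_compl_add S
  rcases le_total (2 * S.ncard) (Fintype.card V) with hS | hS
  · exact key S h1 hS
  · rw [← cutSize_compl]
    exact key _ h2 (by omega)

end FiniteGraph

/-- An expanding sequence remains expanding when the edges at vertices of large degree are removed,
because the removed vertices are few and, as the limit has finite expected degree, are joined by
few edges to the remaining ones. -/
theorem exists_truncated_expansion {V : ℕ → Type} [∀ n, Fintype (V n)] [∀ n, Nonempty (V n)]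
    {G : ∀ n, SimpleGraph (V n)} (hG : IsExpanding G)
    {μ : ProbabilityMeasure RootedGraphSpace} (hμ : LocallyWeaklyConverges G μ)
    (hdeg : ∫⁻ x, (x.rootDegree : ℝ≥0∞) ∂(μ : Measure RootedGraphSpace) < ∞)
    {δ : ℝ} (hδ : 0 < δ) (hδ' : δ ≤ 1) :
    ∃ c : ℝ, 0 < c ∧ ∃ M : ℕ, ∀ᶠ n in atTop, ∃ K ≤ G n,
      K.edgeSet.ncard ≤ M * Fintype.card (V n) ∧
      ∀ S : Set (V n), δ * Fintype.card (V n) ≤ S.ncard → δ * Fintype.card (V n) ≤ (Sᶜ).ncard →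
        c * Fintype.card (V n) ≤ cutSize K S := by
  obtain ⟨b, hb0, hb⟩ := exists_between (hG (δ / 2) (by linarith) (by linarith))
  have hbtop : b ≠ ∞ := hb.ne_top
  have hc0 : 0 < b.toReal := ENNReal.toReal_pos hb0.ne' hbtop
  have hexp := eventually_lt_of_lt_liminf hb
  set c := b.toReal * δ / 8 with hc
  have hcpos : 0 < c := by positivity
  obtain ⟨M, hM1, hM2⟩ := (((tendsto_integral_nearHighDegree hdeg).eventually
    (gt_mem_nhds hcpos)).and ((tendsto_integral_highDegree (μ := μ)).eventually
    (gt_mem_nhds (half_pos hδ)))).exists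
  have hT1 := (hμ.tendsto_average (isLocal_nearHighDegree M) (C := M) (fun x => by
    rw [Nat.abs_cast]; exact_mod_cast nearHighDegree_le' x.graph M x.root)).eventually (gt_mem_nhds hM1)
  have hT2 := (hμ.tendsto_average (isLocal_highDegree M) (C := 1) (fun x => by
    rw [Nat.abs_cast]; exact_mod_cast highDegree_le_one x.graph M x.root)).eventually (gt_mem_nhds hM2)
  refine ⟨c, hcpos, M, ?_⟩
  filter_upwards [hexp, hT1, hT2] with n hn h1 h2
  refine ⟨lowDegreeGraph (G n) M, lowDegreeGraph_le _ _, ncard_edgeSet_lowDegreeGraph_le _ _, ?_⟩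
  intro S hS hS'
  have hpos : (0 : ℝ) < Fintype.card (V n) := by exact_mod_cast Fintype.card_pos
  simp only [nearHighDegree_rootedComponent, highDegree_rootedComponent] at h1 h2
  rw [div_lt_iff₀ hpos, ← Nat.cast_sum] at h1 h2
  rw [sum_highDegree] at h2
  set H : Set (V n) := {v | M < vertexDegree (G n) v}
  have h3 : (S.ncard : ℝ) ≤ (S \ H).ncard + H.ncard := by
    exact_mod_cast Set.ncard_le_ncard_sdiff_add_ncard S H
  have h4 : ((Sᶜ).ncard : ℝ) ≤ ((S \ H)ᶜ).ncard := by
    exact_mod_cast Set.ncard_le_ncard (Set.compl_subset_compl.2 Set.sdiff_subset)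
  have h5 := le_cutSize_of_le_expansionConstant (G n) hc0.le (δ := δ / 2) (S := S \ H)
    (by rw [ENNReal.ofReal_toReal hbtop]; exact hn.le) (by linarith)
    (by nlinarith)
  have h6 : (cutSize (G n) (S \ H) : ℝ) ≤
      cutSize (lowDegreeGraph (G n) M) S + ((∑ v, nearHighDegree (G n) M v : ℕ) : ℝ) := by
    exact_mod_cast cutSize_sdiff_le (G n) M S
  have h7 : b.toReal * (δ / 2 * Fintype.card (V n)) = 4 * c * Fintype.card (V n) := by
    rw [hc]; ring
  have h8 : 0 < c * Fintype.card (V n) := by positivity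
  linarith

/-! ### Concentration of the number of vertices in large clusters -/

/-- The vertices that can be reached from `v` in at most `R` steps. -/
def walkBall {V : Type} (G : SimpleGraph V) (v : V) (R : ℕ) : Set V :=
  {w | ∃ p : G.Walk v w, p.length ≤ R}

section Independence

variable {V : Type} {G : SimpleGraph V}

/-- The edges of `G` inside the ball of radius `k` around `v`. -/
def ballEdges (G : SimpleGraph V) (k : ℕ) (v : V) : Set (Sym2 V) :=
  {e ∈ G.edgeSet | ∀ w ∈ e, w ∈ walkBall G v k}

theorem bigCluster_congr_of_ballEdges {k : ℕ} {v : V} {ω ω' : Set (Sym2 V)}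
    (hω : ω ⊆ G.edgeSet) (hω' : ω' ⊆ G.edgeSet)
    (h : ∀ e ∈ ballEdges G k v, e ∈ ω ↔ e ∈ ω') :
    BigCluster k (openGraph ω) v ↔ BigCluster k (openGraph ω') v := by
  have hb : ∀ u, (∃ p : G.Walk v u, p.length ≤ k) →
      u ∈ Set.range (Subtype.val : walkBall G v k → V) := fun u hu => ⟨⟨u, hu⟩, rfl⟩
  have h1 := bigCluster_comap_iff (G := G) (f := (Subtype.val : walkBall G v k → V))
    Subtype.val_injective (w₀ := ⟨v, .nil, by simp⟩) hb hω
  have h2 := bigCluster_comap_iff (G := G) (f := (Subtype.val : walkBall G v k → V))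
    Subtype.val_injective (w₀ := ⟨v, .nil, by simp⟩) hb hω'
  rw [← h1, ← h2]
  suffices Sym2.map (Subtype.val : walkBall G v k → V) ⁻¹' ω =
      Sym2.map (Subtype.val : walkBall G v k → V) ⁻¹' ω' by rw [this]
  ext e
  simp only [Set.mem_preimage]
  have hball : ∀ w ∈ Sym2.map (Subtype.val : walkBall G v k → V) e, w ∈ walkBall G v k := by
    intro w hw
    obtain ⟨a, -, rfl⟩ := Sym2.mem_map.1 hw
    exact a.2
  exact ⟨fun he => (h _ ⟨hω he, hball⟩).1 he, fun he => (h _ ⟨hω' he, hball⟩).2 he⟩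

theorem disjoint_ballEdges {k : ℕ} {u v : V} (h : v ∉ walkBall G u (2 * k)) :
    Disjoint (ballEdges G k u) (ballEdges G k v) := by
  rw [Set.disjoint_left]
  intro e he he'
  induction e using Sym2.ind with
  | _ a b =>
    obtain ⟨p, hp⟩ := he.2 a (Sym2.mem_mk_left a b)
    obtain ⟨q, hq⟩ := he'.2 a (Sym2.mem_mk_left a b)
    refine h ⟨p.append q.reverse, ?_⟩
    rw [SimpleGraph.Walk.length_append, SimpleGraph.Walk.length_reverse]
    omega

/-- At two vertices at distance more than `2 * k`, the events of having a cluster of size at least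
`k` are independent. -/
theorem percolation_bigCluster_indep [Finite V] (p : I) {k : ℕ} {u v : V}
    (h : v ∉ walkBall G u (2 * k)) :
    (percolation G p).real
        ({ω | BigCluster k (openGraph ω) u} ∩ {ω | BigCluster k (openGraph ω) v}) =
      (percolation G p).real {ω | BigCluster k (openGraph ω) u} *
        (percolation G p).real {ω | BigCluster k (openGraph ω) v} := by
  have hfin : Finite (Sym2 V) := inferInstance
  set S := ballEdges G k u with hS
  have hSG : S ⊆ G.edgeSet := fun e he => he.1
  have hU := setBernoulli_prod_map_union_of_disjoint
    (Set.disjoint_sdiff_right : Disjoint S (G.edgeSet \ S)) p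
  rw [Set.union_sdiff_cancel hSG] at hU
  set P := ProbabilityTheory.setBernoulli S p
  set Q := ProbabilityTheory.setBernoulli (G.edgeSet \ S) p
  have hae : ∀ᵐ z ∂P.prod Q, z.1 ⊆ S ∧ z.2 ⊆ G.edgeSet \ S :=
    (Measure.quasiMeasurePreserving_fst.ae ProbabilityTheory.setBernoulli_ae_subset).and
      (Measure.quasiMeasurePreserving_snd.ae ProbabilityTheory.setBernoulli_ae_subset)
  have h1 : ∀ᵐ z ∂P.prod Q, (BigCluster k (openGraph (z.1 ∪ z.2)) u ↔
      BigCluster k (openGraph z.1) u) := by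
    filter_upwards [hae] with z hz
    refine bigCluster_congr_of_ballEdges (G := G)
      (Set.union_subset (hz.1.trans hSG) (hz.2.trans Set.sdiff_subset)) (hz.1.trans hSG) ?_
    intro e he
    exact ⟨fun h => h.resolve_right fun h' => (hz.2 h').2 he, Or.inl⟩
  have h2 : ∀ᵐ z ∂P.prod Q, (BigCluster k (openGraph (z.1 ∪ z.2)) v ↔
      BigCluster k (openGraph z.2) v) := by
    filter_upwards [hae] with z hz
    refine bigCluster_congr_of_ballEdges (G := G)
      (Set.union_subset (hz.1.trans hSG) (hz.2.trans Set.sdiff_subset))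
      (hz.2.trans Set.sdiff_subset) ?_
    intro e he
    exact ⟨fun h' => h'.resolve_left fun h'' =>
      Set.disjoint_left.1 (disjoint_ballEdges h) (hz.1 h'') he, Or.inr⟩
  have e1 : (percolation G p).real {ω | BigCluster k (openGraph ω) u} =
      P.real {ω | BigCluster k (openGraph ω) u} := by
    rw [percolation, ← hU, map_measureReal_apply measurable_union_pair (measurableSet_of_finite _)]
    rw [measureReal_congr (t := {ω | BigCluster k (openGraph ω) u} ×ˢ Set.univ),
      measureReal_prod_prod, probReal_univ, mul_one]
    filter_upwards [h1] with z hz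
    refine propext (hz.trans ⟨fun h => ⟨h, trivial⟩, fun h => h.1⟩)
  have e2 : (percolation G p).real {ω | BigCluster k (openGraph ω) v} =
      Q.real {ω | BigCluster k (openGraph ω) v} := by
    rw [percolation, ← hU, map_measureReal_apply measurable_union_pair (measurableSet_of_finite _)]
    rw [measureReal_congr (t := Set.univ ×ˢ {ω | BigCluster k (openGraph ω) v}),
      measureReal_prod_prod, probReal_univ, one_mul]
    filter_upwards [h2] with z hz
    refine propext (hz.trans ⟨fun h => ⟨trivial, h⟩, fun h => h.2⟩)
  rw [e1, e2, ← measureReal_prod_prod, percolation, ← hU,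
    map_measureReal_apply measurable_union_pair (measurableSet_of_finite _)]
  refine measureReal_congr ?_
  filter_upwards [h1, h2] with z hz1 hz2
  exact propext (and_congr hz1 hz2)

end Independence

/-- The number of vertices whose cluster has at least `k` vertices. -/
noncomputable def bigCount {V : Type} (k : ℕ) (ω : Set (Sym2 V)) : ℕ :=
  {v | BigCluster k (openGraph ω) v}.ncard

section SecondMoment

variable {V : Type} [Fintype V] (G : SimpleGraph V)

theorem integrable_of_finite {E : Type*} [NormedAddCommGroup E] (p : I)
    (f : Set (Sym2 V) → E) : Integrable f (percolation G p) := by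
  have : Finite (Sym2 V) := inferInstance
  exact Integrable.of_finite

theorem bigCount_eq_sum (k : ℕ) (ω : Set (Sym2 V)) :
    (bigCount k ω : ℝ) =
      ∑ v, Set.indicator {ω | BigCluster k (openGraph ω) v} (fun _ => (1 : ℝ)) ω := by
  classical
  simp only [Set.indicator_apply, Set.mem_ofPred_eq, Finset.sum_boole, Nat.cast_inj]
  rw [bigCount, ← Set.ncard_coe_finset]
  simp

theorem integral_bigCount (p : I) (k : ℕ) :
    ∫ ω, (bigCount k ω : ℝ) ∂percolation G p =
      ∑ v, (percolation G p).real {ω | BigCluster k (openGraph ω) v} := by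
  simp only [bigCount_eq_sum]
  rw [integral_finsetSum _ fun v _ => integrable_of_finite G p _]
  refine Finset.sum_congr rfl fun v _ => ?_
  rw [integral_indicator_const _ (measurableSet_of_finite _), smul_eq_mul, mul_one]

theorem variance_bigCount_le (p : I) (k : ℕ) :
    ProbabilityTheory.variance (fun ω => (bigCount k ω : ℝ)) (percolation G p) ≤
      ∑ u, ((walkBall G u (2 * k)).ncard : ℝ) := by
  classical
  have hfin : Finite (Sym2 V) := inferInstance
  rw [ProbabilityTheory.variance_eq_sub (MemLp.of_discrete), integral_bigCount]
  have h1 : ∫ ω, ((fun ω => (bigCount k ω : ℝ)) ^ 2) ω ∂percolation G p =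
      ∑ u, ∑ v, (percolation G p).real
        ({ω | BigCluster k (openGraph ω) u} ∩ {ω | BigCluster k (openGraph ω) v}) := by
    simp only [Pi.pow_apply, bigCount_eq_sum, sq, Finset.sum_mul_sum]
    rw [integral_finsetSum _ fun v _ => integrable_of_finite G p _]
    refine Finset.sum_congr rfl fun u _ => ?_
    rw [integral_finsetSum _ fun v _ => integrable_of_finite G p _]
    refine Finset.sum_congr rfl fun v _ => ?_
    simp only [← Set.inter_indicator_mul, mul_one]
    rw [integral_indicator_const _ (measurableSet_of_finite _), smul_eq_mul, mul_one]
  rw [h1, sq, Finset.sum_mul_sum, ← Finset.sum_sub_distrib]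
  refine Finset.sum_le_sum fun u _ => ?_
  rw [← Finset.sum_sub_distrib]
  have h2 : ((walkBall G u (2 * k)).ncard : ℝ) =
      ∑ v, if v ∈ walkBall G u (2 * k) then (1 : ℝ) else 0 := by
    rw [Finset.sum_boole, Nat.cast_inj, ← Set.ncard_coe_finset]
    simp
  rw [h2]
  refine Finset.sum_le_sum fun v _ => ?_
  split_ifs with hv
  · have h3 : (percolation G p).real
        ({ω | BigCluster k (openGraph ω) u} ∩ {ω | BigCluster k (openGraph ω) v}) ≤ 1 :=
      measureReal_le_one
    have h4 : 0 ≤ (percolation G p).real {ω | BigCluster k (openGraph ω) u} *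
        (percolation G p).real {ω | BigCluster k (openGraph ω) v} :=
      mul_nonneg measureReal_nonneg measureReal_nonneg
    linarith
  · rw [percolation_bigCluster_indep p hv, sub_self]

end SecondMoment

open Classical in
/-- The indicator function of having more than `T` vertices in the ball of radius `R`. -/
noncomputable def largeBall (R T : ℕ) (x : RootedGraph) : ℝ :=
  if T < (x.ball R).ncard then 1 else 0

theorem isLocal_largeBall (R T : ℕ) : IsLocal R (largeBall R T) := by
  rintro x y ⟨φ, -⟩
  have : (x.ball R).ncard = (y.ball R).ncard := Nat.card_congr φ.toEquiv
  simp only [largeBall, this]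

theorem abs_largeBall_le (R T : ℕ) (x : RootedGraph) : |largeBall R T x| ≤ 1 := by
  unfold largeBall; split <;> norm_num

theorem tendsto_integral_largeBall (μ : ProbabilityMeasure RootedGraphSpace) (R : ℕ) :
    Tendsto (fun T => ∫ x, RootedGraphSpace.lift (largeBall R T) x
      ∂(μ : Measure RootedGraphSpace)) atTop (𝓝 0) := by
  have h := tendsto_integral_of_dominated_convergence (μ := (μ : Measure RootedGraphSpace))
    (F := fun T => RootedGraphSpace.lift (largeBall R T)) (f := fun _ => 0)
    (fun _ => 1)
    (fun T => (RootedGraphSpace.continuous_lift (isLocal_largeBall R T)).aestronglyMeasurable)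
    (integrable_const _) (fun T => ae_of_all _ fun _ => abs_largeBall_le R T _)
    (ae_of_all _ fun x => ?_)
  · simpa using h
  · refine tendsto_const_nhds.congr' ?_
    filter_upwards [eventually_ge_atTop ((Quotient.out x).ball R).ncard] with T hT
    rw [RootedGraphSpace.lift, largeBall, if_neg (by omega)]

theorem ncard_walkBall_le {V : Type} [Finite V] (G : SimpleGraph V) (v : V) (R : ℕ) :
    (walkBall G v R).ncard ≤ ((rootedComponent G v).ball R).ncard := by
  have hsub : walkBall G v R ⊆ (Subtype.val : (G.connectedComponentMk v) → V) ''
      (rootedComponent G v).ball R := by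
    rintro w ⟨p, hp⟩
    have hmem : ∀ u, G.Reachable v u → u ∈ G.connectedComponentMk v := fun u hu =>
      (SimpleGraph.ConnectedComponent.eq.2 hu).symm
    have key : ∀ (a b : V) (q : G.Walk a b) (ha : a ∈ G.connectedComponentMk v)
        (hb : b ∈ G.connectedComponentMk v),
        ∃ q' : (G.connectedComponentMk v).toSimpleGraph.Walk ⟨a, ha⟩ ⟨b, hb⟩,
          q'.length ≤ q.length := by
      intro a b q
      induction q with
      | nil => intro ha hb; exact ⟨.nil, le_rfl⟩
      | @cons a c b hac q ih =>
        intro ha hb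
        have hc : c ∈ G.connectedComponentMk v :=
          hmem c ((SimpleGraph.ConnectedComponent.eq.1 ha).symm.trans hac.reachable)
        obtain ⟨q', hq'⟩ := ih hc hb
        have hadj : (G.connectedComponentMk v).toSimpleGraph.Adj ⟨a, ha⟩ ⟨c, hc⟩ := hac
        exact ⟨.cons hadj q', by simp only [SimpleGraph.Walk.length_cons]; omega⟩
    obtain ⟨q', hq'⟩ := key v w p (hmem v (SimpleGraph.Reachable.refl _)) (hmem w ⟨p⟩)
    exact ⟨⟨w, hmem w ⟨p⟩⟩, (rootedComponent G v).mem_ball_of_walk ⟨q', hq'.trans hp⟩, rfl⟩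
  have : Finite (rootedComponent G v).V := inferInstanceAs (Finite (G.connectedComponentMk v))
  exact (Set.ncard_le_ncard hsub).trans (Set.ncard_image_le (Set.toFinite _))

section Sequence

variable {V : ℕ → Type} [∀ n, Fintype (V n)] [∀ n, Nonempty (V n)] {G : ∀ n, SimpleGraph (V n)}
  {μ : ProbabilityMeasure RootedGraphSpace}

/-- The balls of a fixed radius are tight, so two random vertices are unlikely to be close. -/
theorem eventually_sum_walkBall_le (hμ : LocallyWeaklyConverges G μ)
    (hV : Tendsto (fun n => (Fintype.card (V n) : ℝ)) atTop atTop) (R : ℕ) {ε : ℝ} (hε : 0 < ε) :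
    ∀ᶠ n in atTop, ∑ u, ((walkBall (G n) u R).ncard : ℝ) ≤ ε * (Fintype.card (V n) : ℝ) ^ 2 := by
  obtain ⟨T, hT⟩ := ((tendsto_integral_largeBall μ R).eventually
    (gt_mem_nhds (half_pos hε))).exists
  have h1 := (hμ.tendsto_average (isLocal_largeBall R T) (abs_largeBall_le R T)).eventually
    (gt_mem_nhds hT)
  filter_upwards [h1, hV.eventually_ge_atTop (2 * T / ε)] with n hn hn'
  have hpos : (0 : ℝ) < Fintype.card (V n) := by exact_mod_cast Fintype.card_pos
  rw [div_lt_iff₀ hpos] at hn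
  rw [div_le_iff₀ hε] at hn'
  have h2 : ∀ u, ((walkBall (G n) u R).ncard : ℝ) ≤
      T + Fintype.card (V n) * largeBall R T (rootedComponent (G n) u) := by
    intro u
    unfold largeBall
    split_ifs with h
    · have : (walkBall (G n) u R).ncard ≤ Fintype.card (V n) := by
        rw [← Nat.card_eq_fintype_card]; exact Set.ncard_le_card _
      have : ((walkBall (G n) u R).ncard : ℝ) ≤ Fintype.card (V n) := by exact_mod_cast this
      have := Nat.cast_nonneg (α := ℝ) T
      linarith
    · have : ((walkBall (G n) u R).ncard : ℝ) ≤ T := by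
        exact_mod_cast (ncard_walkBall_le (G n) u R).trans (not_lt.1 h)
      linarith
  refine (Finset.sum_le_sum fun u _ => h2 u).trans ?_
  rw [Finset.sum_add_distrib, ← Finset.mul_sum, Finset.sum_const, Finset.card_univ, nsmul_eq_mul]
  nlinarith

theorem tendsto_bigProb_average (hμ : LocallyWeaklyConverges G μ) (k : ℕ) (p : I) :
    Tendsto (fun n => (∑ v, (percolation (G n) p).real {ω | BigCluster k (openGraph ω) v}) /
      Fintype.card (V n)) atTop
      (𝓝 (∫ x, RootedGraphSpace.lift (RootedGraph.bigProb k p) x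
        ∂(μ : Measure RootedGraphSpace))) := by
  have h := hμ.tendsto_average (isLocal_bigProb k p) (abs_bigProb_le k p)
  simpa only [RootedGraph.bigProb_rootedComponent] using h

/-- The fraction of vertices in clusters of size at least `k` is, with high probability, not much
less than the probability that the root of the limit has such a cluster. -/
theorem tendsto_bigCount_lt (hμ : LocallyWeaklyConverges G μ)
    (hV : Tendsto (fun n => (Fintype.card (V n) : ℝ)) atTop atTop) (k : ℕ) (p : I) {β : ℝ}
    (hβ : β < ∫ x, RootedGraphSpace.lift (RootedGraph.bigProb k p) x
      ∂(μ : Measure RootedGraphSpace)) :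
    Tendsto (fun n => (percolation (G n) p).real
      {ω | (bigCount k ω : ℝ) < β * Fintype.card (V n)}) atTop (𝓝 0) := by
  obtain ⟨γ, hγ, hγ'⟩ := exists_between hβ
  have hd : 0 < γ - β := sub_pos.2 hγ
  refine (tendsto_order.2 ⟨fun a ha => Eventually.of_forall fun n =>
    lt_of_lt_of_le ha measureReal_nonneg, fun ε hε => ?_⟩)
  filter_upwards [(tendsto_bigProb_average hμ k p).eventually (lt_mem_nhds hγ'),
    eventually_sum_walkBall_le hμ hV (2 * k) (show 0 < (γ - β) ^ 2 * (ε / 2) by positivity)]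
    with n h1 h2
  have hfin : Finite (Sym2 (V n)) := inferInstance
  have hpos : (0 : ℝ) < Fintype.card (V n) := by exact_mod_cast Fintype.card_pos
  rw [lt_div_iff₀ hpos, ← integral_bigCount] at h1
  have hc : 0 < (γ - β) * Fintype.card (V n) := mul_pos hd hpos
  have h3 := ProbabilityTheory.meas_ge_le_variance_div_sq (μ := percolation (G n) p)
    (X := fun ω => (bigCount k ω : ℝ)) MemLp.of_discrete hc
  have h4 : (percolation (G n) p).real {ω | (bigCount k ω : ℝ) < β * Fintype.card (V n)} ≤
      ProbabilityTheory.variance (fun ω => (bigCount k ω : ℝ)) (percolation (G n) p) /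
        ((γ - β) * Fintype.card (V n)) ^ 2 := by
    refine ENNReal.toReal_le_of_le_ofReal
      (div_nonneg (ProbabilityTheory.variance_nonneg _ _) (sq_nonneg _)) (le_trans ?_ h3)
    refine measure_mono fun ω hω => ?_
    rw [Set.mem_ofPred_eq] at hω ⊢
    rw [abs_sub_comm]
    refine le_trans ?_ (le_abs_self _)
    linarith
  refine h4.trans_lt ?_
  rw [div_lt_iff₀ (by positivity)]
  refine (variance_bigCount_le (G n) p k).trans_lt (h2.trans_lt ?_)
  have : 0 < (γ - β) ^ 2 * (Fintype.card (V n) : ℝ) ^ 2 * ε := by positivity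
  nlinarith

/-- As the limit is almost surely infinite, the finite graphs grow. -/
theorem tendsto_card_atTop (hμ : LocallyWeaklyConverges G μ)
    (hinf : ∀ᵐ x ∂(μ : Measure RootedGraphSpace), x.IsInfinite) :
    Tendsto (fun n => (Fintype.card (V n) : ℝ)) atTop atTop := by
  refine tendsto_natCast_atTop_iff.2 (tendsto_atTop.2 fun k => ?_)
  -- With edge probability `1`, the cluster of the root is the whole graph.
  have h1 : ∫ x, RootedGraphSpace.lift (RootedGraph.bigProb k 1) x
      ∂(μ : Measure RootedGraphSpace) = 1 := by
    rw [integral_congr_ae (g := fun _ => (1 : ℝ)) ?_]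
    · simp
    · filter_upwards [hinf] with x hx
      rw [← Quotient.out_eq x] at hx
      change Infinite (Quotient.out x).V at hx
      set y := Quotient.out x
      have : BigCluster k (openGraph y.graph.edgeSet) y.root := by
        refine forall_bigCluster_iff.2 ?_ k
        have : {w | (openGraph y.graph.edgeSet).Reachable y.root w} = Set.univ := by
          ext w
          simp only [openGraph, SimpleGraph.fromEdgeSet_edgeSet, Set.mem_ofPred_eq, Set.mem_univ,
            iff_true]
          exact y.connected.preconnected _ _
        rw [this]
        exact Set.infinite_univ
      have h3 : Measure.dirac y.graph.edgeSet {ω | BigCluster k (openGraph ω) y.root} = 1 :=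
        Measure.dirac_apply_of_mem this
      change (percolation y.graph 1 {ω | BigCluster k (openGraph ω) y.root}).toReal = 1
      rw [percolation, ProbabilityTheory.setBernoulli_one, h3, ENNReal.toReal_one]
  have h2 := (tendsto_bigProb_average hμ k 1).eventually (lt_mem_nhds (a := 0) (by rw [h1]; norm_num))
  filter_upwards [h2] with n hn
  by_contra! hlt
  refine hn.ne' ?_
  rw [Finset.sum_eq_zero, zero_div]
  intro v _
  have : {ω : Set (Sym2 (V n)) | BigCluster k (openGraph ω) v} = ∅ := by
    ext ω
    simp only [Set.mem_ofPred_eq, Set.mem_empty_iff_false, iff_false]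
    intro hb
    have h3 : (k : ℕ∞) ≤ (Set.univ : Set (V n)).encard :=
      le_trans hb (Set.encard_le_encard (Set.subset_univ _))
    rw [Set.encard_univ, ENat.card_eq_coe_fintype_card] at h3
    have : k ≤ Fintype.card (V n) := by exact_mod_cast h3
    omega
  rw [this]
  simp

end Sequence

/-! ### The absence of a giant component -/

section LargestComponent

variable {V : Type} {H : SimpleGraph V}

theorem bigCluster_iff_ncard [Finite V] {k : ℕ} {v : V} :
    BigCluster k H v ↔ k ≤ {w | H.Reachable v w}.ncard := by
  rw [BigCluster, ← (Set.toFinite _).cast_ncard_eq, Nat.cast_le]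

theorem supp_eq_reachable (v : V) :
    (H.connectedComponentMk v).supp = {w | H.Reachable v w} := by
  ext w
  rw [SimpleGraph.ConnectedComponent.mem_supp_iff, SimpleGraph.ConnectedComponent.eq]
  exact SimpleGraph.reachable_comm

variable [Finite V]

theorem ncard_cluster_le (v : V) : {w | H.Reachable v w}.ncard ≤ largestComponentSize H := by
  rw [← supp_eq_reachable]
  have : Finite H.ConnectedComponent := Quot.finite _
  exact le_ciSup (f := fun C : H.ConnectedComponent => C.supp.ncard) (Set.finite_range _).bddAbove
    (H.connectedComponentMk v)

theorem exists_ncard_cluster_eq [Nonempty V] :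
    ∃ v, {w | H.Reachable v w}.ncard = largestComponentSize H := by
  have : Finite H.ConnectedComponent := Quot.finite _
  have : Nonempty H.ConnectedComponent := Nonempty.map H.connectedComponentMk inferInstance
  obtain ⟨C, hC⟩ := exists_eq_ciSup_of_finite (f := fun C : H.ConnectedComponent => C.supp.ncard)
  induction C using SimpleGraph.ConnectedComponent.ind with
  | _ v =>
    refine ⟨v, ?_⟩
    rw [← supp_eq_reachable]
    exact hC

theorem largestComponentSize_le_bigCount [Nonempty V] {k : ℕ} {ω : Set (Sym2 V)}
    (h : k ≤ largestComponentSize (openGraph ω)) :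
    largestComponentSize (openGraph ω) ≤ bigCount k ω := by
  obtain ⟨v, hv⟩ := exists_ncard_cluster_eq (H := openGraph ω)
  rw [← hv] at h ⊢
  exact Set.ncard_le_ncard fun w hw => (bigCluster_iff_ncard.2 h).of_reachable hw

end LargestComponent

section Subcritical

variable {V : ℕ → Type} [∀ n, Fintype (V n)] [∀ n, Nonempty (V n)] {G : ∀ n, SimpleGraph (V n)}
  {μ : ProbabilityMeasure RootedGraphSpace}

/-- If the root of the limit does not percolate, then the largest component is of smaller order than
the number of vertices: its vertices lie in clusters of size at least `k`, for every fixed `k`. -/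
theorem tendsto_giant_zero (hμ : LocallyWeaklyConverges G μ)
    (hV : Tendsto (fun n => (Fintype.card (V n) : ℝ)) atTop atTop) {p : I}
    (hp : percolationProb μ p = 0) {α : ℝ} (hα : 0 < α) :
    Tendsto (fun n => (percolation (G n) p).real
      {ω | α * (Fintype.card (V n) : ℝ) < (largestComponentSize (openGraph ω) : ℝ)})
      atTop (𝓝 0) := by
  refine (tendsto_order.2 ⟨fun a ha => Eventually.of_forall fun n =>
    lt_of_lt_of_le ha measureReal_nonneg, fun ε hε => ?_⟩)
  have h := tendsto_integral_bigProb μ p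
  rw [hp] at h
  obtain ⟨k, hk⟩ := (h.eventually (gt_mem_nhds (mul_pos hε hα))).exists
  filter_upwards [(tendsto_bigProb_average hμ k p).eventually (gt_mem_nhds hk),
    hV.eventually_ge_atTop (k / α)] with n h1 h2
  have hpos : (0 : ℝ) < Fintype.card (V n) := by exact_mod_cast Fintype.card_pos
  rw [div_lt_iff₀ hpos, ← integral_bigCount] at h1
  rw [div_le_iff₀ hα] at h2
  have h3 := mul_meas_ge_le_integral_of_nonneg (μ := percolation (G n) p)
    (f := fun ω => (bigCount k ω : ℝ)) (ae_of_all _ fun _ => Nat.cast_nonneg _)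
    (integrable_of_finite (G n) p _) (α * Fintype.card (V n))
  have h4 : (percolation (G n) p).real
      {ω | α * (Fintype.card (V n) : ℝ) < (largestComponentSize (openGraph ω) : ℝ)} ≤
      (percolation (G n) p).real {ω | α * (Fintype.card (V n) : ℝ) ≤ (bigCount k ω : ℝ)} := by
    refine measureReal_mono fun ω hω => ?_
    rw [Set.mem_ofPred_eq] at hω ⊢
    have h5 : k ≤ largestComponentSize (openGraph ω) := by
      have : (k : ℝ) < largestComponentSize (openGraph ω) := by linarith
      exact_mod_cast this.le
    have h6 : (largestComponentSize (openGraph ω) : ℝ) ≤ bigCount k ω := by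
      exact_mod_cast largestComponentSize_le_bigCount h5
    linarith
  refine h4.trans_lt ?_
  have hc : 0 < α * Fintype.card (V n) := mul_pos hα hpos
  have h7 := h3.trans_lt h1
  exact lt_of_mul_lt_mul_left (h7.trans_eq (by ring)) hc.le

end Subcritical

/-! ### The existence of a giant component -/

/-- Nonnegative weights of size at most `x / 4` whose sum is at least `x` have a partial sum between
`x / 4` and `x / 2`. -/
theorem exists_balanced_subset {ι : Type*} (s : Finset ι) (w : ι → ℝ) {x : ℝ}
    (hw : ∀ i ∈ s, w i ≤ x / 4) (hs : x ≤ ∑ i ∈ s, w i) (hx : 0 < x) :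
    ∃ D ⊆ s, x / 4 ≤ ∑ i ∈ D, w i ∧ ∑ i ∈ D, w i ≤ x / 2 := by
  classical
  have key : ∀ t ⊆ s, ∑ i ∈ t, w i < x / 4 ∨
      ∃ D ⊆ t, x / 4 ≤ ∑ i ∈ D, w i ∧ ∑ i ∈ D, w i ≤ x / 2 := by
    intro t
    induction t using Finset.induction_on with
    | empty => intro _; left; simpa using hx
    | insert a t ha ih =>
      intro hts
      rcases ih ((Finset.subset_insert a t).trans hts) with h | ⟨D, hD, h⟩
      · rcases lt_or_ge (∑ i ∈ insert a t, w i) (x / 4) with h' | h'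
        · exact Or.inl h'
        · refine Or.inr ⟨_, subset_rfl, h', ?_⟩
          rw [Finset.sum_insert ha]
          have := hw a (hts (Finset.mem_insert_self a t))
          linarith
      · exact Or.inr ⟨D, hD.trans (Finset.subset_insert a t), h⟩
  rcases key s subset_rfl with h | h
  · linarith
  · exact h

section UnionBound

variable {V : Type} [Fintype V]

open Classical in
/-- The connected components of `H` with at least `k` vertices. -/
noncomputable def bigComponents (k : ℕ) (H : SimpleGraph V) : Finset H.ConnectedComponent :=
  (Finset.univ.image H.connectedComponentMk).filter fun C => k ≤ C.supp.ncard

theorem mem_bigComponents {k : ℕ} {H : SimpleGraph V} {v : V} :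
    H.connectedComponentMk v ∈ bigComponents k H ↔ BigCluster k H v := by
  classical
  rw [bigComponents, Finset.mem_filter, supp_eq_reachable, ← bigCluster_iff_ncard]
  exact and_iff_right (Finset.mem_image_of_mem _ (Finset.mem_univ v))

theorem card_bigComponents_mul_le (k : ℕ) (H : SimpleGraph V) :
    (bigComponents k H).card * k ≤ Fintype.card V := by
  classical
  have h1 : ∀ C ∈ bigComponents k H,
      k ≤ ((Finset.univ : Finset V).filter fun v => H.connectedComponentMk v = C).card := by
    intro C hC
    rw [bigComponents, Finset.mem_filter] at hC
    refine hC.2.trans (le_of_eq ?_)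
    rw [← Set.ncard_coe_finset]
    congr 1
    ext v
    simp [SimpleGraph.ConnectedComponent.mem_supp_iff]
  calc (bigComponents k H).card * k
      ≤ ∑ C ∈ bigComponents k H,
          ((Finset.univ : Finset V).filter fun v => H.connectedComponentMk v = C).card := by
        rw [← smul_eq_mul]
        exact Finset.card_nsmul_le_sum _ _ _ h1
    _ = ((bigComponents k H).biUnion fun C =>
          (Finset.univ : Finset V).filter fun v => H.connectedComponentMk v = C).card := by
        rw [Finset.card_biUnion]
        intro C _ C' _ hCC'
        refine Finset.disjoint_left.2 fun v hv hv' => ?_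
        simp only [Finset.mem_filter, Finset.mem_univ, true_and] at hv hv'
        exact hCC' (hv.symm.trans hv')
    _ ≤ Fintype.card V := Finset.card_le_univ _

/-- If no component of `ω ∪ η` is large, then the large clusters of `ω` can be divided into two
groups, each with many vertices, that are not joined by `η`. -/
theorem exists_separated_groups {k : ℕ} {ω η : Set (Sym2 V)} {x : ℝ} (hx : 0 < x)
    (hω : x ≤ bigCount k ω) (hη : (largestComponentSize (openGraph (ω ∪ η)) : ℝ) ≤ x / 4) :
    ∃ T ∈ (bigComponents k (openGraph ω)).powerset,
      x / 4 ≤ {v | (openGraph ω).connectedComponentMk v ∈ T}.ncard ∧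
      x / 4 ≤ {v | BigCluster k (openGraph ω) v ∧ (openGraph ω).connectedComponentMk v ∉ T}.ncard ∧
      ¬ OpenJoined η {v | (openGraph ω).connectedComponentMk v ∈ T}
        {v | BigCluster k (openGraph ω) v ∧ (openGraph ω).connectedComponentMk v ∉ T} := by
  classical
  set H := openGraph (ω ∪ η) with hH
  let mk := H.connectedComponentMk
  let Big : Finset V := Finset.univ.filter fun v => BigCluster k (openGraph ω) v
  have hBig : (Big.card : ℝ) = bigCount k ω := by
    rw [bigCount, ← Set.ncard_coe_finset]
    simp [Big]
  let w : H.ConnectedComponent → ℝ := fun C => ((Big.filter fun v => mk v = C).card : ℝ)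
  have hsum : ∀ D : Finset H.ConnectedComponent,
      ∑ C ∈ D, w C = ((Big.filter fun v => mk v ∈ D).card : ℝ) := by
    intro D
    have hmaps : Set.MapsTo mk (Big.filter fun v => mk v ∈ D : Finset V) (D : Set _) :=
      fun v hv => (Finset.mem_filter.1 (Finset.mem_coe.1 hv)).2
    rw [← Nat.cast_sum, Nat.cast_inj, Finset.card_eq_sum_card_fiberwise hmaps]
    refine Finset.sum_congr rfl fun C hC => ?_
    congr 1
    ext v
    simp only [Finset.mem_filter]
    constructor
    · rintro ⟨h1, rfl⟩; exact ⟨⟨h1, hC⟩, rfl⟩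
    · rintro ⟨⟨h1, -⟩, rfl⟩; exact ⟨h1, rfl⟩
  obtain ⟨D, -, hD1, hD2⟩ := exists_balanced_subset (Finset.univ.image mk) w (x := x)
    (fun C hC => by
      obtain ⟨u, -, rfl⟩ := Finset.mem_image.1 hC
      refine le_trans ?_ hη
      have : (Big.filter fun v => mk v = mk u).card ≤ {v | H.Reachable u v}.ncard := by
        rw [← Set.ncard_coe_finset]
        refine Set.ncard_le_ncard fun v hv => ?_
        have hv' := (Finset.mem_filter.1 (Finset.mem_coe.1 hv)).2
        exact (SimpleGraph.ConnectedComponent.eq.1 hv').symm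
      exact Nat.cast_le.2 (this.trans (ncard_cluster_le u)))
    (by
      rw [hsum, Finset.filter_true_of_mem, hBig]
      · exact hω
      · intro v _; exact Finset.mem_image_of_mem _ (Finset.mem_univ v)) hx
  rw [hsum] at hD1 hD2
  -- the `ω`-clusters that lie in the components from `D`
  let T := (bigComponents k (openGraph ω)).filter
    fun C => ∃ u, mk u ∈ D ∧ (openGraph ω).connectedComponentMk u = C
  have hωH : openGraph ω ≤ H := openGraph_mono Set.subset_union_left
  have hmemT : ∀ v, (openGraph ω).connectedComponentMk v ∈ T ↔
      BigCluster k (openGraph ω) v ∧ mk v ∈ D := by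
    intro v
    rw [Finset.mem_filter, mem_bigComponents]
    refine and_congr_right fun _ => ⟨?_, fun h => ⟨v, h, rfl⟩⟩
    rintro ⟨u, hu, huv⟩
    have : mk u = mk v := SimpleGraph.ConnectedComponent.eq.2
      ((SimpleGraph.ConnectedComponent.eq.1 huv).mono hωH)
    rwa [← this]
  have hmemT' : ∀ v, BigCluster k (openGraph ω) v ∧ (openGraph ω).connectedComponentMk v ∉ T ↔
      BigCluster k (openGraph ω) v ∧ mk v ∉ D := by
    intro v
    rw [hmemT]
    tauto
  have h1 : {v | (openGraph ω).connectedComponentMk v ∈ T}.ncard =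
      (Big.filter fun v => mk v ∈ D).card := by
    rw [← Set.ncard_coe_finset]
    congr 1
    ext v
    simp [hmemT, Big]
  have h2 : {v | BigCluster k (openGraph ω) v ∧ (openGraph ω).connectedComponentMk v ∉ T}.ncard =
      (Big.filter fun v => ¬ mk v ∈ D).card := by
    rw [← Set.ncard_coe_finset]
    congr 1
    ext v
    simp only [Set.mem_ofPred_eq, hmemT']
    simp [Big]
  have h3 : ((Big.filter fun v => mk v ∈ D).card : ℝ) + (Big.filter fun v => ¬ mk v ∈ D).card =
      Big.card := by
    exact_mod_cast Finset.card_filter_add_card_filter_not (s := Big) (fun v => mk v ∈ D)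
  refine ⟨T, Finset.mem_powerset.2 (Finset.filter_subset _ _), ?_, ?_, ?_⟩
  · rw [h1]; exact hD1
  · rw [h2]; linarith
  · rintro ⟨a, ha, b, hb, hab⟩
    rw [Set.mem_ofPred_eq, hmemT] at ha
    rw [Set.mem_ofPred_eq, hmemT'] at hb
    have : mk a = mk b := SimpleGraph.ConnectedComponent.eq.2
      (hab.mono (openGraph_mono Set.subset_union_right))
    exact hb.2 (this ▸ ha.2)

/-- The union bound over the divisions of the large clusters into two groups. -/
theorem percolation_no_giant_le {G K : SimpleGraph V} (hK : K ≤ G) (s : I) {k L t j : ℕ}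
    {ω : Set (Sym2 V)} {x : ℝ} (hx : 0 < x) (hω : x ≤ bigCount k ω)
    (hE : K.edgeSet.ncard < L * t)
    (hcut : ∀ S : Set V, x / 4 ≤ S.ncard → x / 4 ≤ (Sᶜ).ncard → t + j * L ≤ cutSize K S) :
    (percolation G s).real {η | (largestComponentSize (openGraph (ω ∪ η)) : ℝ) ≤ x / 4} ≤
      2 ^ (bigComponents k (openGraph ω)).card * (1 - (s : ℝ) ^ L) ^ j := by
  classical
  let A : Finset (openGraph ω).ConnectedComponent → Set V :=
    fun T => {v | (openGraph ω).connectedComponentMk v ∈ T}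
  let B : Finset (openGraph ω).ConnectedComponent → Set V :=
    fun T => {v | BigCluster k (openGraph ω) v ∧ (openGraph ω).connectedComponentMk v ∉ T}
  let E : Finset (openGraph ω).ConnectedComponent → Set (Set (Sym2 V)) :=
    fun T => {η | x / 4 ≤ (A T).ncard ∧ x / 4 ≤ (B T).ncard ∧ ¬ OpenJoined η (A T) (B T)}
  have hs0 : (0 : ℝ) ≤ s := s.2.1
  have hs1 : (s : ℝ) ≤ 1 := s.2.2
  have hr : 0 ≤ 1 - (s : ℝ) ^ L := sub_nonneg.2 (pow_le_one₀ hs0 hs1)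
  have h1 : {η | (largestComponentSize (openGraph (ω ∪ η)) : ℝ) ≤ x / 4} ⊆
      ⋃ T ∈ (bigComponents k (openGraph ω)).powerset, E T := by
    intro η hη
    obtain ⟨T, hT, h⟩ := exists_separated_groups hx hω hη
    exact Set.mem_biUnion hT h
  have h2 : ∀ T, (percolation G s).real (E T) ≤ (1 - (s : ℝ) ^ L) ^ j := by
    intro T
    by_cases hT : x / 4 ≤ (A T).ncard ∧ x / 4 ≤ (B T).ncard
    · refine (measureReal_mono (s₂ := {η | ¬ OpenJoined η (A T) (B T)}) fun η hη => hη.2.2).trans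
        ((percolation_not_joined_mono hK s _ _).trans
        (percolation_not_joined_le s j K hE fun S hAS hSB => hcut S ?_ ?_))
      · exact hT.1.trans (by exact_mod_cast Set.ncard_le_ncard hAS)
      · exact hT.2.trans (by
          exact_mod_cast Set.ncard_le_ncard (Set.subset_compl_iff_disjoint_left.2 hSB))
    · have : E T = ∅ := by
        ext η
        simp only [Set.mem_empty_iff_false, iff_false]
        exact fun hη => hT ⟨hη.1, hη.2.1⟩
      rw [this, measureReal_empty]
      exact pow_nonneg hr j
  refine (measureReal_mono h1 (measure_ne_top _ _)).trans ((measureReal_biUnion_finset_le _ _).trans ?_)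
  refine (Finset.sum_le_card_nsmul _ _ _ fun T _ => h2 T).trans ?_
  rw [Finset.card_powerset, nsmul_eq_mul, Nat.cast_pow, Nat.cast_ofNat]

end UnionBound

theorem prod_real_le_of_forall {α β : Type*} [MeasurableSpace α] [MeasurableSpace β]
    {P : Measure α} {Q : Measure β} [IsProbabilityMeasure P] [IsProbabilityMeasure Q]
    {E : Set (α × β)} (hE : MeasurableSet E) {b : ℝ} (hb : 0 ≤ b)
    (h : ∀ x, Q.real (Prod.mk x ⁻¹' E) ≤ b) : (P.prod Q).real E ≤ b := by
  refine ENNReal.toReal_le_of_le_ofReal hb ?_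
  rw [Measure.prod_apply hE]
  calc ∫⁻ x, Q (Prod.mk x ⁻¹' E) ∂P ≤ ∫⁻ _, ENNReal.ofReal b ∂P := by
        refine lintegral_mono fun x => ?_
        rw [← ENNReal.ofReal_toReal (measure_ne_top Q _)]
        exact ENNReal.ofReal_le_ofReal (h x)
    _ = ENNReal.ofReal b := by simp

section Supercritical

variable {V : ℕ → Type} [∀ n, Fintype (V n)] [∀ n, Nonempty (V n)] {G : ∀ n, SimpleGraph (V n)}
  {μ : ProbabilityMeasure RootedGraphSpace}

/-- The exponents in the union bound for `exists_giant`: there are `m ≤ N / k` large clusters, and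
a division of them is not bridged with probability at most `(1 - s ^ L) ^ j`, where `j` is
proportional to `N`. -/
theorem two_pow_mul_pow_le_exp {s : ℝ} (hs0 : 0 ≤ s) (hs1 : s ≤ 1) {L j m k : ℕ} {a N : ℝ}
    (hk : 0 < k) (hm : (m : ℝ) * k ≤ N) (hj : a * N - 1 ≤ j) (hN : 0 ≤ N)
    (hka : 1 / (k : ℝ) ≤ s ^ L * a / 2) :
    2 ^ m * (1 - s ^ L) ^ j ≤ Real.exp (1 - s ^ L * a / 2 * N) := by
  have hl0 : 0 ≤ s ^ L := pow_nonneg hs0 L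
  have hl1 : s ^ L ≤ 1 := pow_le_one₀ hs0 hs1
  have h1 : (2 : ℝ) ^ m ≤ Real.exp m := by
    rw [← Real.exp_one_pow]
    refine pow_le_pow_left₀ (by norm_num) ?_ m
    have := Real.add_one_le_exp 1
    linarith
  have h2 : (1 - s ^ L) ^ j ≤ Real.exp (-(s ^ L) * j) := by
    rw [mul_comm, Real.exp_nat_mul]
    refine pow_le_pow_left₀ (by linarith) ?_ j
    have := Real.add_one_le_exp (-(s ^ L))
    linarith
  refine (mul_le_mul h1 h2 (pow_nonneg (by linarith) j) (Real.exp_pos _).le).trans ?_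
  rw [← Real.exp_add]
  refine Real.exp_le_exp.2 ?_
  have hk' : (0 : ℝ) < k := by exact_mod_cast hk
  have h3 : (m : ℝ) ≤ N * (1 / k) := by
    rw [mul_one_div, le_div_iff₀ hk']; exact hm
  have h4 : N * (1 / k) ≤ N * (s ^ L * a / 2) := mul_le_mul_of_nonneg_left hka hN
  have h5 : s ^ L * (a * N - 1) ≤ s ^ L * j := mul_le_mul_of_nonneg_left hj hl0
  nlinarith

/-- Above an edge probability at which the root of the limit percolates, there is a giant component
with high probability. -/
theorem exists_giant (hG : IsExpanding G) (hμ : LocallyWeaklyConverges G μ)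
    (hdeg : ∫⁻ x, (x.rootDegree : ℝ≥0∞) ∂(μ : Measure RootedGraphSpace) < ∞)
    (hV : Tendsto (fun n => (Fintype.card (V n) : ℝ)) atTop atTop) {p q : I} (hpq : p < q)
    (hp : 0 < percolationProb μ p) :
    ∃ α : ℝ, 0 < α ∧ Tendsto (fun n => (percolation (G n) q).real
      {ω | (largestComponentSize (openGraph ω) : ℝ) ≤ α * (Fintype.card (V n) : ℝ)})
      atTop (𝓝 0) := by
  obtain ⟨s, hs, hU⟩ := exists_sprinkle hpq
  have hs0 : (0 : ℝ) < s := hs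
  have hs1 : (s : ℝ) ≤ 1 := s.2.2
  have hp1 : percolationProb μ p ≤ 1 := by
    refine (integral_mono (integrable_lift_infProb p μ) (integrable_const 1)
      fun x => ?_).trans (by simp)
    exact measureReal_le_one
  set β := percolationProb μ p / 2 with hβ
  have hβ0 : 0 < β := half_pos hp
  -- The constants `c`, `M`, `L` are fixed before `k`, so it matters that `β` bounds the density of
  -- clusters of size at least `k` for all `k` at once.
  obtain ⟨c, hc, M, hTE⟩ := exists_truncated_expansion hG hμ hdeg (δ := β / 4) (by positivity)
    (by linarith)
  obtain ⟨L, hL⟩ := exists_nat_gt (M / (c / 4))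
  have hL0 : (0 : ℝ) < L := lt_of_le_of_lt (by positivity) hL
  rw [div_lt_iff₀ (by positivity)] at hL
  set a := c / (4 * L) with ha
  have ha0 : 0 < a := by positivity
  have hl0 : 0 < (s : ℝ) ^ L := pow_pos hs0 L
  obtain ⟨k, hk⟩ := exists_nat_one_div_lt (show 0 < (s : ℝ) ^ L * a / 2 by positivity)
  have hβk : β < ∫ x, RootedGraphSpace.lift (RootedGraph.bigProb (k + 1) p) x
      ∂(μ : Measure RootedGraphSpace) :=
    lt_of_lt_of_le (by linarith) (percolationProb_le μ p (k + 1))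
  have hconc := tendsto_bigCount_lt hμ hV (k + 1) p hβk
  have hexp : Tendsto (fun n => Real.exp (1 - (s : ℝ) ^ L * a / 2 * Fintype.card (V n)))
      atTop (𝓝 0) := by
    refine Real.tendsto_exp_atBot.comp ?_
    exact tendsto_atBot_add_const_left _ 1
      (tendsto_neg_atTop_atBot.comp (hV.const_mul_atTop (by positivity)))
  refine ⟨β / 4, by positivity, ?_⟩
  have hsum := hconc.add hexp
  rw [add_zero] at hsum
  refine tendsto_of_tendsto_of_tendsto_of_le_of_le' tendsto_const_nhds hsum
    (Eventually.of_forall fun n => measureReal_nonneg) ?_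
  filter_upwards [hTE, hV.eventually_ge_atTop (2 / c)] with n ⟨K, hKG, hKE, hKcut⟩ hn
  have hfin : Finite (Sym2 (V n)) := inferInstance
  have hpos : (0 : ℝ) < Fintype.card (V n) := by exact_mod_cast Fintype.card_pos
  set N : ℝ := (Fintype.card (V n) : ℝ) with hN
  rw [div_le_iff₀ hc] at hn
  -- A quarter of each cut is kept as the reserve `t` that guarantees short paths, another quarter is
  -- spent on the `j` successive paths, and the rest absorbs the rounding.
  set t := ⌈c / 4 * N⌉₊ with ht
  set j := ⌊a * N⌋₊ with hj
  have ht1 : c / 4 * N ≤ t := Nat.le_ceil _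
  have ht2 : (t : ℝ) < c / 4 * N + 1 := Nat.ceil_lt_add_one (by positivity)
  have hj1 : (j : ℝ) ≤ a * N := Nat.floor_le (by positivity)
  have hj2 : a * N < j + 1 := Nat.lt_floor_add_one _
  have hE : K.edgeSet.ncard < L * t := by
    have h1 : (K.edgeSet.ncard : ℝ) ≤ M * N := by rw [hN]; exact_mod_cast hKE
    have h2 : M * N < L * (c / 4) * N := mul_lt_mul_of_pos_right hL hpos
    have h3 : L * (c / 4 * N) ≤ L * t := mul_le_mul_of_nonneg_left ht1 hL0.le
    have : (K.edgeSet.ncard : ℝ) < L * t := by linarith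
    exact_mod_cast this
  have hcut : ∀ S : Set (V n), β * N / 4 ≤ S.ncard → β * N / 4 ≤ (Sᶜ).ncard →
      t + j * L ≤ cutSize K S := by
    intro S h1 h2
    have h3 := hKcut S (by linarith) (by linarith)
    have h4 : (j : ℝ) * L ≤ a * N * L := mul_le_mul_of_nonneg_right hj1 hL0.le
    have h5 : a * N * L = c / 4 * N := by rw [ha]; field_simp
    have : ((t + j * L : ℕ) : ℝ) ≤ cutSize K S := by
      push_cast
      linarith
    exact_mod_cast this
  let E1 : Set (Set (Sym2 (V n)) × Set (Sym2 (V n))) :=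
    {ω | (bigCount (k + 1) ω : ℝ) < β * N} ×ˢ Set.univ
  let E2 : Set (Set (Sym2 (V n)) × Set (Sym2 (V n))) :=
    {z | β * N ≤ (bigCount (k + 1) z.1 : ℝ) ∧
      (largestComponentSize (openGraph (z.1 ∪ z.2)) : ℝ) ≤ β * N / 4}
  have hsplit : (percolation (G n) q).real
      {ω | (largestComponentSize (openGraph ω) : ℝ) ≤ β / 4 * N} ≤
      ((percolation (G n) p).prod (percolation (G n) s)).real (E1 ∪ E2) := by
    conv_lhs => rw [percolation, ← hU]
    rw [map_measureReal_apply measurable_union_pair (measurableSet_of_finite _)]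
    refine measureReal_mono ?_
    rintro ⟨ω, η⟩ h
    have h' : (largestComponentSize (openGraph (ω ∪ η)) : ℝ) ≤ β / 4 * N := h
    rcases lt_or_ge (bigCount (k + 1) ω : ℝ) (β * N) with hlt | hge
    · exact Or.inl ⟨hlt, trivial⟩
    · exact Or.inr ⟨hge, by linarith⟩
  refine hsplit.trans ((measureReal_union_le _ _).trans (add_le_add ?_ ?_))
  · rw [measureReal_prod_prod, probReal_univ, mul_one]
  · refine prod_real_le_of_forall (Set.toFinite _).measurableSet (Real.exp_pos _).le fun ω => ?_
    by_cases hω : β * N ≤ (bigCount (k + 1) ω : ℝ)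
    · refine (measureReal_mono (s₂ := {η | (largestComponentSize (openGraph (ω ∪ η)) : ℝ) ≤
        β * N / 4}) fun η hη => hη.2).trans ?_
      refine (percolation_no_giant_le hKG s (by positivity) hω hE hcut).trans ?_
      refine two_pow_mul_pow_le_exp hs0.le hs1 (Nat.succ_pos k) ?_ (by linarith) hpos.le ?_
      · rw [hN]
        exact_mod_cast card_bigComponents_mul_le (k + 1) (openGraph ω)
      · push_cast; exact hk.le
    · have : Prod.mk ω ⁻¹' E2 = ∅ := by
        ext η
        simp only [Set.mem_empty_iff_false, iff_false]
        exact fun hη => hω hη.1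
      rw [this, measureReal_empty]
      exact (Real.exp_pos _).le

end Supercritical

/-! ### The giant component reaches almost every neighborhood -/

/-- In a graph whose cuts are large, all but few vertices are close to a given large set. -/
theorem ncard_far_lt {V : Type} [Fintype V] [Nonempty V] {K : SimpleGraph V} {δ c : ℝ} {M L : ℕ}
    (hL : M < L * c) (hE : K.edgeSet.ncard ≤ M * Fintype.card V)
    (hcut : ∀ S : Set V, δ * Fintype.card V ≤ S.ncard → δ * Fintype.card V ≤ (Sᶜ).ncard →
      c * Fintype.card V ≤ cutSize K S)
    {W : Set V} (hW : δ * Fintype.card V ≤ W.ncard) :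
    ({v | ¬ ∃ w ∈ W, ∃ p : K.Walk w v, p.length ≤ L}.ncard : ℝ) < δ * Fintype.card V := by
  by_contra hfar
  rw [not_lt] at hfar
  have hpos : (0 : ℝ) < Fintype.card V := by exact_mod_cast Fintype.card_pos
  obtain ⟨a, ha, b, hb, p, hp⟩ := exists_short_walk (K := K) (A := W)
    (B := {v | ¬ ∃ w ∈ W, ∃ p : K.Walk w v, p.length ≤ L}) (L := L)
    (t := ⌈c * Fintype.card V⌉₊) (fun S hWS hSB => by
      refine Nat.ceil_le.2 (hcut S ?_ ?_)
      · exact hW.trans (by exact_mod_cast Set.ncard_le_ncard hWS)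
      · exact hfar.trans (Nat.cast_le.2
          (Set.ncard_le_ncard (Set.subset_compl_iff_disjoint_left.2 hSB))))
    (by
      have h1 : (K.edgeSet.ncard : ℝ) ≤ M * Fintype.card V := by exact_mod_cast hE
      have h2 : M * (Fintype.card V : ℝ) < L * c * Fintype.card V :=
        mul_lt_mul_of_pos_right hL hpos
      have h3 : (L : ℝ) * (c * Fintype.card V) ≤ L * ⌈c * Fintype.card V⌉₊ :=
        mul_le_mul_of_nonneg_left (Nat.le_ceil _) (Nat.cast_nonneg _)
      have : (K.edgeSet.ncard : ℝ) < L * ⌈c * Fintype.card V⌉₊ := by linarith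
      exact_mod_cast this)
  exact hb ⟨a, ha, p, hp⟩

theorem pow_le_percolation_bigCluster {V : Type} [Finite V] {G K : SimpleGraph V} (hK : K ≤ G)
    (s : I) {k L : ℕ} {ω : Set (Sym2 V)} {v w : V} (hw : BigCluster k (openGraph ω) w)
    (hp : ∃ p : K.Walk w v, p.length ≤ L) :
    (s : ℝ) ^ L ≤ (percolation G s).real {η | BigCluster k (openGraph (ω ∪ η)) v} := by
  classical
  obtain ⟨p, hp⟩ := hp
  have hF : ((p.edges.toFinset : Finset (Sym2 V)) : Set (Sym2 V)) ⊆ G.edgeSet := by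
    intro e he
    exact SimpleGraph.edgeSet_mono hK (p.edges_subset_edgeSet (by simpa using he))
  have hcard : p.edges.toFinset.card ≤ L := by
    refine (List.toFinset_card_le _).trans ?_
    rwa [SimpleGraph.Walk.length_edges]
  refine (pow_le_pow_of_le_one s.2.1 s.2.2 hcard).trans ?_
  rw [← percolation_real_superset hF s]
  refine measureReal_mono fun η hη => ?_
  refine BigCluster.of_reachable ?_ (hw.mono_graph (openGraph_mono Set.subset_union_left))
  exact reachable_openGraph_of_walk p fun e he => Or.inr (hη (by simpa using he))

theorem prod_real_eq_integral {α β : Type*} [MeasurableSpace α] [MeasurableSpace β]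
    {P : Measure α} {Q : Measure β} [IsProbabilityMeasure P] [IsProbabilityMeasure Q]
    {E : Set (α × β)} (hE : MeasurableSet E) :
    (P.prod Q).real E = ∫ x, Q.real (Prod.mk x ⁻¹' E) ∂P := by
  rw [measureReal_def, Measure.prod_apply hE]
  exact (integral_toReal (measurable_measure_prodMk_left hE).aemeasurable
    (ae_of_all _ fun x => measure_lt_top _ _)).symm

/-- Sprinkling attaches to a giant component at `p`, each with probability at least `s ^ L`, at least
half of the vertices of a given large set `Q`. -/
theorem sum_percolation_bigCluster_ge {V : Type} [Fintype V] [Nonempty V] {G K : SimpleGraph V}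
    (hK : K ≤ G) {p q s : I}
    (hU : ((ProbabilityTheory.setBernoulli G.edgeSet p).prod
      (ProbabilityTheory.setBernoulli G.edgeSet s)).map (fun x => x.1 ∪ x.2) =
        ProbabilityTheory.setBernoulli G.edgeSet q)
    {δ c α : ℝ} {M L k : ℕ} (hL : M < L * c) (hE : K.edgeSet.ncard ≤ M * Fintype.card V)
    (hcut : ∀ S : Set V, δ * Fintype.card V ≤ S.ncard → δ * Fintype.card V ≤ (Sᶜ).ncard →
      c * Fintype.card V ≤ cutSize K S)
    (hδα : δ ≤ α) (hk : k ≤ α * Fintype.card V) (Q : Finset V)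
    (hQ : 2 * δ * Fintype.card V ≤ Q.card) :
    δ * Fintype.card V * (s : ℝ) ^ L * (percolation G p).real
        {ω | α * (Fintype.card V : ℝ) < (largestComponentSize (openGraph ω) : ℝ)} ≤
      ∑ v ∈ Q, (percolation G q).real {ω | BigCluster k (openGraph ω) v} := by
  classical
  have hfin : Finite (Sym2 V) := inferInstance
  let Y : Set (Sym2 V) → ℝ := fun ω =>
    ∑ v ∈ Q, (percolation G s).real {η | BigCluster k (openGraph (ω ∪ η)) v}
  have hsum : ∑ v ∈ Q, (percolation G q).real {ω | BigCluster k (openGraph ω) v} =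
      ∫ ω, Y ω ∂percolation G p := by
    rw [integral_finsetSum _ fun v _ => integrable_of_finite G p _]
    refine Finset.sum_congr rfl fun v _ => ?_
    conv_lhs => rw [percolation, ← hU]
    rw [map_measureReal_apply measurable_union_pair (measurableSet_of_finite _),
      prod_real_eq_integral (Set.toFinite _).measurableSet]
    rfl
  rw [hsum]
  have h1 := mul_meas_ge_le_integral_of_nonneg (μ := percolation G p) (f := Y)
    (ae_of_all _ fun _ => Finset.sum_nonneg fun _ _ => measureReal_nonneg)
    (integrable_of_finite G p _) (δ * Fintype.card V * (s : ℝ) ^ L)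
  rcases le_or_gt δ 0 with hδ0 | hδ0
  · refine le_trans (mul_nonpos_of_nonpos_of_nonneg ?_ measureReal_nonneg)
      (integral_nonneg fun _ => Finset.sum_nonneg fun _ _ => measureReal_nonneg)
    exact mul_nonpos_of_nonpos_of_nonneg
      (mul_nonpos_of_nonpos_of_nonneg hδ0 (Nat.cast_nonneg _)) (pow_nonneg s.2.1 L)
  have hc0 : 0 ≤ δ * Fintype.card V * (s : ℝ) ^ L :=
    mul_nonneg (by positivity) (pow_nonneg s.2.1 L)
  refine le_trans (mul_le_mul_of_nonneg_left (measureReal_mono fun ω hω => ?_) hc0) h1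
  rw [Set.mem_ofPred_eq] at hω ⊢
  obtain ⟨v₀, hv₀⟩ := exists_ncard_cluster_eq (H := openGraph ω)
  rw [← hv₀] at hω
  have hfar := ncard_far_lt hL hE hcut (W := {w | (openGraph ω).Reachable v₀ w})
    ((mul_le_mul_of_nonneg_right hδα (Nat.cast_nonneg _)).trans hω.le)
  set Far := {v | ¬ ∃ w ∈ {w | (openGraph ω).Reachable v₀ w}, ∃ p : K.Walk w v, p.length ≤ L}
  have hbig : BigCluster k (openGraph ω) v₀ := by
    rw [bigCluster_iff_ncard]
    have : (k : ℝ) ≤ {w | (openGraph ω).Reachable v₀ w}.ncard := by linarith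
    exact_mod_cast this
  have h2 : ∀ v ∈ Q.filter fun v => v ∉ Far, (s : ℝ) ^ L ≤
      (percolation G s).real {η | BigCluster k (openGraph (ω ∪ η)) v} := by
    intro v hv
    obtain ⟨w, hw, hp⟩ := not_not.1 (Finset.mem_filter.1 hv).2
    exact pow_le_percolation_bigCluster hK s (hbig.of_reachable hw) hp
  have h3 : δ * Fintype.card V ≤ (Q.filter fun v => v ∉ Far).card := by
    have h4 : Q.card ≤ (Q.filter fun v => v ∉ Far).card + Far.ncard := by
      rw [← Finset.card_filter_add_card_filter_not (s := Q) (fun v => v ∉ Far)]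
      refine Nat.add_le_add_left ?_ _
      rw [← Set.ncard_coe_finset]
      refine Set.ncard_le_ncard fun v hv => ?_
      exact not_not.1 (Finset.mem_filter.1 (Finset.mem_coe.1 hv)).2
    have h5 : (Q.card : ℝ) ≤ (Q.filter fun v => v ∉ Far).card + Far.ncard := by exact_mod_cast h4
    linarith
  calc δ * Fintype.card V * (s : ℝ) ^ L
      ≤ (Q.filter fun v => v ∉ Far).card * (s : ℝ) ^ L :=
        mul_le_mul_of_nonneg_right h3 (pow_nonneg s.2.1 L)
    _ ≤ ∑ v ∈ Q.filter fun v => v ∉ Far,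
          (percolation G s).real {η | BigCluster k (openGraph (ω ∪ η)) v} := by
        rw [← nsmul_eq_mul]
        exact Finset.card_nsmul_le_sum _ _ _ h2
    _ ≤ Y ω := Finset.sum_le_sum_of_subset_of_nonneg (Finset.filter_subset _ _)
        fun _ _ _ => measureReal_nonneg

open Classical in
/-- The indicator function of having a cluster of size at least `k` with probability less
than `ε`. -/
noncomputable def smallBigProb (k : ℕ) (p : I) (ε : ℝ) (x : RootedGraph) : ℝ :=
  if x.bigProb k p < ε then 1 else 0

theorem isLocal_smallBigProb (k : ℕ) (p : I) (ε : ℝ) : IsLocal k (smallBigProb k p ε) := by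
  intro x y h
  simp only [smallBigProb, h.bigProb_eq p]

theorem abs_smallBigProb_le (k : ℕ) (p : I) (ε : ℝ) (x : RootedGraph) :
    |smallBigProb k p ε x| ≤ 1 := by
  unfold smallBigProb; split <;> norm_num

section Dichotomy

variable {V : ℕ → Type} [∀ n, Fintype (V n)] [∀ n, Nonempty (V n)] {G : ∀ n, SimpleGraph (V n)}
  {μ : ProbabilityMeasure RootedGraphSpace}

/-- If the root of the limit percolates with positive probability, then for every larger edge
probability almost every realization of the limit percolates. -/
theorem ae_infProb_pos (hG : IsExpanding G) (hμ : LocallyWeaklyConverges G μ)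
    (hdeg : ∫⁻ x, (x.rootDegree : ℝ≥0∞) ∂(μ : Measure RootedGraphSpace) < ∞)
    (hV : Tendsto (fun n => (Fintype.card (V n) : ℝ)) atTop atTop) {p₀ q : I} (hpq : p₀ < q)
    (hp : 0 < percolationProb μ p₀) :
    ∀ᵐ x ∂(μ : Measure RootedGraphSpace),
      0 < RootedGraphSpace.lift (RootedGraph.infProb q) x := by
  classical
  obtain ⟨p, hp₀, hpq'⟩ := exists_between hpq
  obtain ⟨α, hα, hgiant⟩ := exists_giant hG hμ hdeg hV hp₀ hp
  obtain ⟨s, hs, hU⟩ := exists_sprinkle hpq'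
  have hs0 : (0 : ℝ) < s := hs
  by_contra hcon
  set Z : Set RootedGraphSpace :=
    {x | ¬ 0 < RootedGraphSpace.lift (RootedGraph.infProb q) x} with hZ
  have hZ0 : (μ : Measure RootedGraphSpace) Z ≠ 0 := fun h => hcon (ae_iff.2 h)
  have hm : 0 < (μ : Measure RootedGraphSpace).real Z :=
    ENNReal.toReal_pos hZ0 (measure_ne_top _ _)
  have hm1 : (μ : Measure RootedGraphSpace).real Z ≤ 1 := measureReal_le_one
  set m := (μ : Measure RootedGraphSpace).real Z with hmdef
  set δ := min α (m / 4) with hδ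
  have hδ0 : 0 < δ := lt_min hα (by positivity)
  have hδm : δ ≤ m / 4 := min_le_right _ _
  obtain ⟨c, hc, M, hTE⟩ := exists_truncated_expansion hG hμ hdeg hδ0 (by linarith)
  obtain ⟨L, hL⟩ := exists_nat_gt (M / c)
  rw [div_lt_iff₀ hc] at hL
  set ε := δ * (s : ℝ) ^ L / 4 with hε
  have hε0 : 0 < ε := by have := pow_pos hs0 L; positivity
  -- For large `k`, a cluster of size `k` at the root is unlikely on most of the set `Z`.
  obtain ⟨k, hk⟩ : ∃ k, m / 2 < ∫ x, RootedGraphSpace.lift (smallBigProb k q ε) x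
      ∂(μ : Measure RootedGraphSpace) := by
    let A : ℕ → Set RootedGraphSpace :=
      fun k => {x | RootedGraphSpace.lift (RootedGraph.bigProb k q) x < ε}
    have hAmono : Monotone A := fun k l hkl x hx =>
      lt_of_le_of_lt (RootedGraph.antitone_bigProb q (Quotient.out x) hkl) hx
    have hZA : Z ⊆ ⋃ k, A k := by
      intro x hx
      have h0 : RootedGraphSpace.lift (RootedGraph.infProb q) x < ε :=
        lt_of_le_of_lt (not_lt.1 hx) hε0
      obtain ⟨k, hk⟩ := ((RootedGraph.tendsto_bigProb q (Quotient.out x)).eventually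
        (gt_mem_nhds h0)).exists
      exact Set.mem_iUnion.2 ⟨k, hk⟩
    have h1 := (ENNReal.tendsto_toReal (measure_ne_top _ _)).comp
      (tendsto_measure_iUnion_atTop (μ := (μ : Measure RootedGraphSpace)) hAmono)
    have h2 : m / 2 < ((μ : Measure RootedGraphSpace) (⋃ k, A k)).toReal :=
      lt_of_lt_of_le (half_lt_self hm) (measureReal_mono hZA)
    obtain ⟨k, hk⟩ := (h1.eventually (lt_mem_nhds h2)).exists
    refine ⟨k, hk.trans_eq ?_⟩
    have hmeas : MeasurableSet (A k) :=
      (isOpen_lt (RootedGraphSpace.continuous_lift (isLocal_bigProb k q))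
        continuous_const).measurableSet
    have : RootedGraphSpace.lift (smallBigProb k q ε) = (A k).indicator fun _ => (1 : ℝ) := by
      ext x
      simp only [RootedGraphSpace.lift, smallBigProb, Set.indicator_apply]
      rfl
    rw [this, integral_indicator_const _ hmeas, smul_eq_mul, mul_one]
    rfl
  have hQ := (hμ.tendsto_average (isLocal_smallBigProb k q ε)
    (abs_smallBigProb_le k q ε)).eventually (lt_mem_nhds hk)
  obtain ⟨n, ⟨K, hKG, hKE, hKcut⟩, hn1, hn2, hn3⟩ := (hTE.and (hQ.and
    ((hgiant.eventually (gt_mem_nhds (show (0 : ℝ) < 1 / 2 by norm_num))).and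
      (hV.eventually_ge_atTop (k / α))))).exists
  have hfin : Finite (Sym2 (V n)) := inferInstance
  have hpos : (0 : ℝ) < Fintype.card (V n) := by exact_mod_cast Fintype.card_pos
  rw [div_le_iff₀ hα, mul_comm] at hn3
  rw [lt_div_iff₀ hpos] at hn1
  let Q : Finset (V n) := Finset.univ.filter fun v =>
    (percolation (G n) q).real {ω | BigCluster k (openGraph ω) v} < ε
  have hQcard : ∑ v, smallBigProb k q ε (rootedComponent (G n) v) = (Q.card : ℝ) := by
    simp only [smallBigProb, RootedGraph.bigProb_rootedComponent, Finset.sum_boole, Q]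
  rw [hQcard] at hn1
  have hlow := sum_percolation_bigCluster_ge hKG (hU (G n).edgeSet) hL hKE hKcut
    (min_le_left _ _) hn3 Q (by nlinarith)
  have hup : ∑ v ∈ Q, (percolation (G n) q).real {ω | BigCluster k (openGraph ω) v} ≤
      Fintype.card (V n) * ε := by
    refine (Finset.sum_le_card_nsmul Q _ ε fun v hv => (Finset.mem_filter.1 hv).2.le).trans ?_
    rw [nsmul_eq_mul]
    refine mul_le_mul_of_nonneg_right ?_ hε0.le
    exact_mod_cast Finset.card_le_univ Q
  have hcompl : (percolation (G n) p).real
      {ω | α * (Fintype.card (V n) : ℝ) < (largestComponentSize (openGraph ω) : ℝ)} =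
      1 - (percolation (G n) p).real
      {ω | (largestComponentSize (openGraph ω) : ℝ) ≤ α * (Fintype.card (V n) : ℝ)} := by
    rw [← probReal_compl_eq_one_sub (measurableSet_of_finite _)]
    congr 1
    ext ω
    simp
  rw [hcompl] at hlow
  have h1 : δ * Fintype.card (V n) * (s : ℝ) ^ L = 4 * (Fintype.card (V n) * ε) := by
    rw [hε]; ring
  rw [h1] at hlow
  have h2 : 0 < Fintype.card (V n) * ε := mul_pos hpos hε0
  nlinarith

end Dichotomy

/-! ### The critical probability is the threshold for a giant component -/

theorem theorem1 {V : ℕ → Type} [∀ n, Fintype (V n)] [∀ n, Nonempty (V n)]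
    (G : ∀ n, SimpleGraph (V n)) (hG : IsExpanding G)
    (μ : ProbabilityMeasure RootedGraphSpace) (hμ : LocallyWeaklyConverges G μ)
    (hinf : ∀ᵐ x ∂(μ : Measure RootedGraphSpace), x.IsInfinite)
    (hdeg : ∫⁻ x, (x.rootDegree : ℝ≥0∞) ∂(μ : Measure RootedGraphSpace) < ∞) :
    ∃ pc : ℝ,
      (∀ᵐ x ∂(μ : Measure RootedGraphSpace), x.criticalProbability = pc) ∧
      (∀ p : I, (p : ℝ) < pc → ∀ α : ℝ, 0 < α →
        Tendsto (fun n => percolation (G n) p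
          {ω | α * (Fintype.card (V n) : ℝ) < (largestComponentSize (openGraph ω) : ℝ)})
          atTop (𝓝 0)) ∧
      (∀ p : I, pc < (p : ℝ) → ∃ α : ℝ, 0 < α ∧
        Tendsto (fun n => percolation (G n) p
          {ω | α * (Fintype.card (V n) : ℝ) < (largestComponentSize (openGraph ω) : ℝ)})
          atTop (𝓝 1)) := by
  have hV := tendsto_card_atTop hμ hinf
  -- The added point `1` makes `sInf P` the correct threshold if there is no percolation at all.
  set P : Set ℝ := {r : ℝ | ∃ hr : r ∈ I, 0 < percolationProb μ ⟨r, hr⟩} ∪ {1} with hP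
  have hPne : P.Nonempty := ⟨1, Or.inr rfl⟩
  have hPbdd : BddBelow P := by
    refine ⟨0, ?_⟩
    rintro r (⟨hr, -⟩ | rfl)
    · exact hr.1
    · exact zero_le_one
  have hpc1 : sInf P ≤ 1 := csInf_le hPbdd (Or.inr rfl)
  have hsub : ∀ p : I, (p : ℝ) < sInf P → percolationProb μ p = 0 := by
    intro p hp
    by_contra hne
    exact absurd (csInf_le hPbdd (Or.inl ⟨p.2, (percolationProb_nonneg μ p).lt_of_ne' hne⟩))
      (not_le.2 hp)
  have hsup : ∀ p : I, sInf P < p → ∃ p₀ : I, p₀ < p ∧ 0 < percolationProb μ p₀ := by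
    intro p hp
    obtain ⟨r, hr | rfl, hrp⟩ := exists_lt_of_csInf_lt hPne hp
    · obtain ⟨hr, hr'⟩ := hr
      exact ⟨⟨r, hr⟩, hrp, hr'⟩
    · exact absurd hrp (not_lt.2 p.2.2)
  refine ⟨sInf P, ?_, fun p hp α hα => ?_, fun p hp => ?_⟩
  · -- Slightly below the threshold the root almost surely does not percolate, slightly above it
    -- almost every realization percolates.
    have hlow : ∀ᵐ x ∂(μ : Measure RootedGraphSpace), ∀ m : ℕ,
        sInf P - 2 / ((m : ℝ) + 1) ≤ x.criticalProbability := by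
      refine ae_all_iff.2 fun m => ?_
      have hm : (0 : ℝ) < 1 / ((m : ℝ) + 1) := by positivity
      have h2 : 2 / ((m : ℝ) + 1) = 2 * (1 / ((m : ℝ) + 1)) := by ring
      rcases lt_or_ge (sInf P - 2 / ((m : ℝ) + 1)) 0 with h | h
      · refine ae_of_all _ fun x => h.le.trans ?_
        rw [RootedGraphSpace.criticalProbability_eq_out]
        exact RootedGraph.criticalProbability_nonneg _
      · let p₁ : I := ⟨sInf P - 2 / ((m : ℝ) + 1), h, by linarith⟩
        let p₂ : I := ⟨sInf P - 1 / ((m : ℝ) + 1), by linarith, by linarith⟩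
        have h12 : p₁ < p₂ := Subtype.mk_lt_mk.2 (by linarith)
        have h0 : percolationProb μ p₂ = 0 := hsub p₂ (sub_lt_self _ hm)
        filter_upwards [ae_infProb_eq_zero h0] with x hx
        rw [RootedGraphSpace.criticalProbability_eq_out]
        exact RootedGraph.le_criticalProbability _ h12 hx
    have hupp : ∀ᵐ x ∂(μ : Measure RootedGraphSpace), ∀ m : ℕ,
        x.criticalProbability ≤ sInf P + 1 / ((m : ℝ) + 1) := by
      refine ae_all_iff.2 fun m => ?_
      have hm : (0 : ℝ) < 1 / ((m : ℝ) + 1) := by positivity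
      rcases lt_or_ge 1 (sInf P + 1 / ((m : ℝ) + 1)) with h | h
      · refine ae_of_all _ fun x => le_trans ?_ h.le
        rw [RootedGraphSpace.criticalProbability_eq_out]
        exact RootedGraph.criticalProbability_le_one _
      · have hP0 : 0 ≤ sInf P := le_csInf hPne (by
          rintro r (⟨hr, -⟩ | rfl)
          · exact hr.1
          · exact zero_le_one)
        let q : I := ⟨sInf P + 1 / ((m : ℝ) + 1), by linarith, h⟩
        obtain ⟨p₀, hp₀, hpos⟩ := hsup q (lt_add_of_pos_right _ hm)
        filter_upwards [ae_infProb_pos hG hμ hdeg hV hp₀ hpos] with x hx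
        rw [RootedGraphSpace.criticalProbability_eq_out]
        exact RootedGraph.criticalProbability_le (p := q) _ hx
    have hlim1 : Tendsto (fun m : ℕ => sInf P - 2 / ((m : ℝ) + 1)) atTop (𝓝 (sInf P)) := by
      have h := (tendsto_one_div_add_atTop_nhds_zero_nat (𝕜 := ℝ)).const_mul 2
      have h' := h.const_sub (sInf P)
      simp only [mul_zero, sub_zero, mul_one_div] at h'
      exact h'
    have hlim2 : Tendsto (fun m : ℕ => sInf P + 1 / ((m : ℝ) + 1)) atTop (𝓝 (sInf P)) := by
      simpa using (tendsto_one_div_add_atTop_nhds_zero_nat (𝕜 := ℝ)).const_add (sInf P)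
    filter_upwards [hlow, hupp] with x h1 h2
    exact le_antisymm (ge_of_tendsto' hlim2 h2) (le_of_tendsto' hlim1 h1)
  · have h := tendsto_giant_zero hμ hV (hsub p hp) hα
    have h' := ENNReal.tendsto_ofReal h
    rw [ENNReal.ofReal_zero] at h'
    exact h'.congr fun n => ofReal_measureReal
  · obtain ⟨p₀, hp₀, hpos⟩ := hsup p hp
    obtain ⟨α, hα, h⟩ := exists_giant hG hμ hdeg hV hp₀ hpos
    refine ⟨α, hα, ?_⟩
    have h' := ENNReal.tendsto_ofReal (h.const_sub 1)
    rw [sub_zero, ENNReal.ofReal_one] at h'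
    refine h'.congr fun n => ?_
    rw [← probReal_compl_eq_one_sub (measurableSet_of_finite _), ofReal_measureReal]
    congr 1
    ext ω
    simp
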